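/- Let $p$ be a prime, let $n\ge 1$, $r=np$, and let $e_1,\dots,e_r\in\mathbb{C}$ be distinct. Let $X$ be the $p$-gonal surface defined by $y^p=(x-e_1)\cdots(x-e_r)$, that is, the compact connected Riemann surface obtained from this smooth affine plane curve by adding finitely many points, and let $g$ be its genus. Its branch set is $B=\{a_1,\dots,a_r\}$ with $a_i=(e_i,0)\in X$. For a positive integer $m$ with $m\mid 2g-2$, an $m$-spin structure on $X$ is a linear equivalence class of divisors $D$ on $X$ such that $mD$ is linearly equivalent to the canonical divisor $K_X$; it is supported on the branch set if it contains a divisor of the form $\sum_i c_i a_i$ with $c_i\in\mathbb{Z}$. If $m$ is a positive multiple of $p$ such that $m\mid 2g-2$, then the number of $m$-spin structures on $X$ that are supported on the branch set is exactly $p^{r-2}$. -/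

import Mathlib

open scoped Manifold ContDiff Topology

noncomputable section

/-! ### Meromorphic functions and divisors on a Riemann surface

A Riemann surface is a connected Hausdorff space `X` with `[ChartedSpace ℂ X]` and
`[IsManifold 𝓘(ℂ) ω X]`. -/

namespace RiemannSurface

variable (X : Type*) [TopologicalSpace X] [ChartedSpace ℂ X]

variable {X} in
/-- The function `f` is meromorphic on `X`: read in the chart at any point it is meromorphic at that
point. As in Mathlib, a meromorphic function is represented by a complex valued function whose
values at the poles carry no information. -/
def IsMeromorphic (f : X → ℂ) : Prop :=
  ∀ q : X, MeromorphicAt (f ∘ (chartAt ℂ q).symm) (chartAt ℂ q q)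

variable {X} in
/-- The order of the meromorphic function `f` at `q`; it is `⊤` if `f` vanishes near `q`. -/
def order (f : X → ℂ) (q : X) : WithTop ℤ :=
  meromorphicOrderAt (f ∘ (chartAt ℂ q).symm) (chartAt ℂ q q)

/-- Divisors on a compact surface: finite formal sums of points with integer coefficients. -/
abbrev Divisor : Type _ := X →₀ ℤ

variable {X} in
/-- `D` is the divisor of the (not identically zero) meromorphic function `f`. -/
def IsDivisorOf (D : Divisor X) (f : X → ℂ) : Prop :=
  IsMeromorphic f ∧ ∀ q : X, order f q = (D q : WithTop ℤ)

/-- The group of principal divisors. -/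
def principalDivisors : AddSubgroup (Divisor X) where
  carrier := {D | ∃ f : X → ℂ, IsDivisorOf D f}
  zero_mem' := by
    refine ⟨fun _ => 1, fun q => MeromorphicAt.const 1 _, fun q => ?_⟩
    have h : ((fun _ : X => (1 : ℂ)) ∘ (chartAt ℂ q).symm) = fun _ => (1 : ℂ) := rfl
    rw [order, h, meromorphicOrderAt_const]
    simp
  add_mem' := by
    rintro D E ⟨f, hf, hfD⟩ ⟨g, hg, hgE⟩
    refine ⟨f * g, fun q => (hf q).mul (hg q), fun q => ?_⟩
    have h := meromorphicOrderAt_mul (hf q) (hg q)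
    have h1 := hfD q
    have h2 := hgE q
    unfold order at h1 h2 ⊢
    rw [h1, h2] at h
    rw [Finsupp.add_apply]
    exact h
  neg_mem' := by
    rintro D ⟨f, hf, hfD⟩
    refine ⟨f⁻¹, fun q => (hf q).inv, fun q => ?_⟩
    have h := meromorphicOrderAt_inv (f := f ∘ (chartAt ℂ q).symm) (x := chartAt ℂ q q)
    have h1 := hfD q
    unfold order at h1 ⊢
    rw [h1] at h
    rw [Finsupp.neg_apply]
    exact h

/-- Divisors up to linear equivalence. -/
abbrev DivisorClass : Type _ := Divisor X ⧸ principalDivisors X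

/-! ### Differential forms, the canonical class and the genus -/

/-- Sections `q ↦ η q`, without any regularity, of the (holomorphic) cotangent bundle. -/
abbrev OneForm : Type _ := ∀ q : X, TangentSpace 𝓘(ℂ) q →L[ℂ] ℂ

variable {X} in
/-- The coefficient `h` in the expression `η = h(z) dz` of `η` in the chart at `q`, that is, `η`
applied to the coordinate vector field `∂/∂z`. -/
def OneForm.coeff (η : OneForm X) (q : X) (z : ℂ) : ℂ :=
  η ((chartAt ℂ q).symm z) (mfderiv 𝓘(ℂ) 𝓘(ℂ) (chartAt ℂ q).symm z (1 : ℂ))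

variable {X} in
/-- `K` is the divisor of the (not identically zero) meromorphic `1`-form `η`. -/
def IsDivisorOfForm (K : Divisor X) (η : OneForm X) : Prop :=
  ∀ q : X, MeromorphicAt (η.coeff q) (chartAt ℂ q q) ∧
    meromorphicOrderAt (η.coeff q) (chartAt ℂ q q) = (K q : WithTop ℤ)

variable {X} in
/-- `K` is a canonical divisor: the divisor of a nonzero meromorphic `1`-form. -/
def IsCanonical (K : Divisor X) : Prop :=
  ∃ η : OneForm X, IsDivisorOfForm K η

/-- The complex vector space of holomorphic `1`-forms. -/
def holomorphicForms : Submodule ℂ (OneForm X) where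
  carrier := {η | ∀ q : X, AnalyticAt ℂ (η.coeff q) (chartAt ℂ q q)}
  zero_mem' := fun _ => analyticAt_const (v := (0 : ℂ))
  add_mem' := fun ha hb q => (ha q).add (hb q)
  smul_mem' := fun c _ ha q => (analyticAt_const (v := c)).mul (ha q)

/-- The genus of a compact Riemann surface: the dimension of the space of holomorphic `1`-forms. -/
def genus : ℕ := Module.finrank ℂ (holomorphicForms X)

/-! ### Spin structures -/

variable {X} in
/-- The divisor class `c` is an `m`-spin structure: `m • c` is the canonical class. -/
def IsSpin (m : ℕ) (c : DivisorClass X) : Prop :=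
  ∃ K : Divisor X, IsCanonical K ∧ m • c = QuotientAddGroup.mk K

variable {X} in
/-- The divisor class `c` is supported on `B`: it is the class of a divisor all of whose points
belong to `B`. -/
def IsSupportedOn (B : Set X) (c : DivisorClass X) : Prop :=
  ∃ D : Divisor X, (D.support : Set X) ⊆ B ∧ c = QuotientAddGroup.mk D

end RiemannSurface

/-! ### Surfaces defined by `y ^ p = (x - e₁) ⋯ (x - eᵣ)` -/

/-- The affine plane curve `y ^ p = (x - e₁) ⋯ (x - eᵣ)`, as a set of pairs `(x, y)`. -/
def affineCurve (p : ℕ) {r : ℕ} (e : Fin r → ℂ) : Set (ℂ × ℂ) :=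
  {z | z.2 ^ p = ∏ i, (z.1 - e i)}

/-- Data exhibiting `X` as the surface defined by `y ^ p = (x - e₁) ⋯ (x - eᵣ)`: the
affine curve is identified with the complement of finitely many points of `X`, in such a way that
the coordinates `x` and `y` of the curve are holomorphic there. For compact `X` and distinct `eᵢ`
this says that `X` is the smooth compactification of the affine curve. -/
structure PGonalModel (p : ℕ) {r : ℕ} (e : Fin r → ℂ) (X : Type*) [TopologicalSpace X]
    [ChartedSpace ℂ X] where
  /-- the inclusion of the affine curve -/
  emb : affineCurve p e → X
  isOpenEmbedding_emb : Topology.IsOpenEmbedding emb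
  finite_compl_range_emb : (Set.range emb)ᶜ.Finite
  /-- the coordinate `x`, extended by `0` to the points at infinity, is holomorphic on the curve -/
  mdifferentiableOn_x : MDifferentiableOn 𝓘(ℂ) 𝓘(ℂ)
    (Function.extend emb (fun z => z.1.1) (fun _ => (0 : ℂ))) (Set.range emb)
  /-- the coordinate `y`, extended by `0` to the points at infinity, is holomorphic on the curve -/
  mdifferentiableOn_y : MDifferentiableOn 𝓘(ℂ) 𝓘(ℂ)
    (Function.extend emb (fun z => z.1.2) (fun _ => (0 : ℂ))) (Set.range emb)

/-- The branch set of the surface: the points `aᵢ = (eᵢ, 0)`. -/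
def PGonalModel.branchSet {p r : ℕ} {e : Fin r → ℂ} {X : Type*} [TopologicalSpace X]
    [ChartedSpace ℂ X] (M : PGonalModel p e X) : Set X :=
  {q | ∃ z : affineCurve p e, (∃ i, z.1 = (e i, 0)) ∧ M.emb z = q}

end

/-! Everything follows from knowing which divisors `∑ dᵢ aᵢ` are principal: exactly those with `∑ dᵢ
= 0` and all `dᵢ` congruent modulo `p` (`branchDivisor_mem_principalDivisors_iff`).

Such a `d` has the form `p cᵢ + b`, and `∏ (x - eᵢ) ^ cᵢ * y ^ b` realises it, with order zero at
infinity because the sum vanishes. Conversely, let `F` have divisor `∑ dᵢ aᵢ`. Comparing `F ^ p`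
with `∏ (x - eᵢ) ^ dᵢ` gives a function without zeros or poles on the affine part and of order `∑
dᵢ` at every point at infinity; on a compact surface this order must be zero. For the congruences,
let `ρ` be the rotation `y ↦ ζ y`, with `ζ` a primitive `p`-th root of unity. Then `F ∘ ρ / F` is
constant and its limit at `aᵢ` is `ζ ^ dᵢ`, since `y` is a local coordinate there.

The form `∏ (x - eᵢ) ^ cᵢ * y ^ (1 - p) dx` shows that the canonical class contains `∑ p cᵢ aᵢ`
whenever `∑ cᵢ = n (p - 1) - 2`. As `p ∣ m`, the congruences between `m v` and this divisor are
automatic, so `∑ vᵢ aᵢ` is an `m`-spin structure exactly when `∑ vᵢ = (2g - 2) / m`. The vectors of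
a given sum, modulo the lattice above, form `p ^ (r - 2)` classes (`ncard_image_sum_eq`).

The genus is defined as the dimension of the space of holomorphic forms, so `2g - 2 = p (n (p - 1) -
2)` has to be proved. The holomorphic forms are the sums `∑ Pⱼ(x) y⁻ʲ dx` with `0 < j < p` and `deg
Pⱼ ≤ n j - 2`. To expand a given `η`, the traces of `(η / dx) y ^ j` under `x` are shown to be
polynomials and Fourier inversion over the `p` sheets recovers `η / dx`. -/

noncomputable section

/-! ### Complex analysis in one variable -/

section ComplexAnalysis

open Filter Set Polynomial

/-- A complex analytic function that is injective near a point has nonzero derivative there. -/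
theorem AnalyticAt.deriv_ne_zero_of_injOn {g : ℂ → ℂ} {z₀ : ℂ} (hg : AnalyticAt ℂ g z₀)
    {s : Set ℂ} (hs : s ∈ 𝓝 z₀) (hinj : InjOn g s) : deriv g z₀ ≠ 0 := by
  have hg' : AnalyticAt ℂ (fun z => g z - g z₀) z₀ := hg.sub analyticAt_const
  have hne : analyticOrderAt (fun z => g z - g z₀) z₀ ≠ ⊤ := by
    intro h
    rw [analyticOrderAt_eq_top] at h
    have h1 : ∀ᶠ z in 𝓝[≠] z₀, False := by
      filter_upwards [h.filter_mono nhdsWithin_le_nhds, mem_nhdsWithin_of_mem_nhds hs,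
        self_mem_nhdsWithin] with z hz hzs hzne
      exact hzne (hinj hzs (mem_of_mem_nhds hs) (sub_eq_zero.1 hz))
    exact h1.exists.elim fun _ h => h
  obtain ⟨k, hk⟩ := ENat.ne_top_iff_exists.1 hne
  obtain ⟨v, hv, hv0, hgv⟩ := (hg'.analyticOrderAt_eq_natCast (n := k)).1 hk.symm
  have hk0 : k ≠ 0 := by
    rintro rfl
    have := hgv.self_of_nhds
    simp at this
    exact hv0 this.symm
  intro hd
  have hk1 : k ≠ 1 := by
    rintro rfl
    have h1 : deriv (fun z => g z - g z₀) z₀ = v z₀ := by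
      rw [Filter.EventuallyEq.deriv_eq (show (fun z => g z - g z₀) =ᶠ[𝓝 z₀] _ from hgv)]
      have : HasDerivAt (fun z => (z - z₀) ^ 1 • v z) ((1 : ℂ) * v z₀ + (z₀ - z₀) * deriv v z₀) z₀ := by
        simp only [pow_one, smul_eq_mul]
        exact ((hasDerivAt_id z₀).sub_const z₀).mul hv.differentiableAt.hasDerivAt
      simpa using this.deriv
    rw [deriv_sub_const, hd] at h1
    exact hv0 h1.symm
  have hk2 : 1 < k := by omega
  -- a `k`-th root of `g - g z₀`
  obtain ⟨c, hc⟩ := IsAlgClosed.exists_pow_nat_eq (v z₀) (Nat.pos_of_ne_zero hk0)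
  have hc0 : c ≠ 0 := by rintro rfl; rw [zero_pow hk0] at hc; exact hv0 hc.symm
  -- Dividing by `v z₀` makes the base equal to `1` at `z₀`, away from the slit of the principal
  -- power; the constant `c` restores the lost factor.
  set w : ℂ → ℂ := fun z => (v z / v z₀) ^ ((k : ℂ)⁻¹) with hw
  have hwa : AnalyticAt ℂ w z₀ :=
    (hv.div analyticAt_const hv0).cpow analyticAt_const (by simp [hv0])
  have hwk : ∀ z, w z ^ k = v z / v z₀ := fun z => Complex.cpow_nat_inv_pow _ hk0
  have hw1 : w z₀ = 1 := by simp [hw, hv0]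
  set h : ℂ → ℂ := fun z => c * (z - z₀) * w z with hh
  have hha : AnalyticAt ℂ h z₀ := (analyticAt_const.mul (analyticAt_id.sub analyticAt_const)).mul hwa
  have hhd : deriv h z₀ ≠ 0 := by
    have : HasDerivAt h (c * 1 * w z₀ + c * (z₀ - z₀) * deriv w z₀) z₀ :=
      (((hasDerivAt_id z₀).sub_const z₀).const_mul c).mul hwa.differentiableAt.hasDerivAt
    rw [this.deriv, hw1]
    simpa using hc0
  have hgh : ∀ᶠ z in 𝓝 z₀, g z - g z₀ = h z ^ k := by
    filter_upwards [hgv] with z hz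
    rw [hz, hh]
    simp only [mul_pow, hwk, hc, smul_eq_mul]
    field_simp
  -- Since `h` is locally onto, both `u` and `ξ u` are values of `h` for small `u ≠ 0`. The two
  -- preimages have the same `g`, so injectivity would force `ξ = 1`.
  have hmap := hha.hasStrictDerivAt.map_nhds_eq hhd
  have hh0 : h z₀ = 0 := by simp [hh]
  rw [hh0] at hmap
  have hS : h '' {z | z ∈ s ∧ g z - g z₀ = h z ^ k} ∈ 𝓝 (0 : ℂ) := by
    rw [← hmap]
    exact image_mem_map (Filter.inter_mem hs hgh)
  obtain ⟨ξ, hξ⟩ : ∃ ξ : ℂ, IsPrimitiveRoot ξ k := ⟨_, Complex.isPrimitiveRoot_exp k hk0⟩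
  have hS' : ∀ᶠ u in 𝓝 (0 : ℂ), ξ * u ∈ h '' {z | z ∈ s ∧ g z - g z₀ = h z ^ k} := by
    have : Tendsto (fun u : ℂ => ξ * u) (𝓝 0) (𝓝 0) := by
      simpa using (continuous_const_mul ξ).tendsto 0
    exact this hS
  obtain ⟨u, ⟨⟨z, ⟨hzs, hz⟩, hzu⟩, ⟨z', ⟨hzs', hz'⟩, hzu'⟩⟩, hu0⟩ :=
    ((eventually_nhdsWithin_of_eventually_nhds ((show ∀ᶠ u in 𝓝 (0 : ℂ), u ∈ h '' _ from hS).and hS')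
      (s := {0}ᶜ)).and self_mem_nhdsWithin).exists
  have hzz : z = z' := by
    refine hinj hzs hzs' ?_
    have : g z - g z₀ = g z' - g z₀ := by
      rw [hz, hz', hzu, hzu', mul_pow, hξ.pow_eq_one, one_mul]
    simpa using this
  rw [← hzz, hzu] at hzu'
  have : ξ = 1 := by
    have h3 : (ξ - 1) * u = 0 := by rw [sub_mul, one_mul, ← hzu', sub_self]
    rcases mul_eq_zero.1 h3 with h3 | h3
    · exact sub_eq_zero.1 h3
    · exact absurd h3 hu0
  exact hξ.ne_one hk2 this

theorem AnalyticAt.exists_mem_nhds_injOn {g : ℂ → ℂ} {z₀ : ℂ} (hg : AnalyticAt ℂ g z₀)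
    (hd : deriv g z₀ ≠ 0) : ∃ s ∈ 𝓝 z₀, InjOn g s := by
  refine ⟨_, hg.hasStrictDerivAt.eventually_left_inverse hd, fun a ha b hb hab => ?_⟩
  simp only [mem_ofPred_eq] at ha hb
  rw [← ha, ← hb, hab]

/-- Near a nonzero value, `y` can be recovered from `y ^ p`. This makes `x` a local coordinate away
from the branch points and at infinity. -/
theorem exists_mem_nhds_injOn_pow {k : ℕ} (hk : k ≠ 0) {w : ℂ} (hw : w ≠ 0) :
    ∃ s ∈ 𝓝 w, InjOn (fun z : ℂ => z ^ k) s := by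
  refine AnalyticAt.exists_mem_nhds_injOn (analyticAt_id.pow k) ?_
  have := (hasDerivAt_pow k w).deriv
  change deriv (fun x : ℂ => x ^ k) w ≠ 0
  rw [this]
  exact mul_ne_zero (by exact_mod_cast hk) (pow_ne_zero _ hw)

/-- Riemann's removable singularity theorem. The value `f c` is arbitrary, so it is replaced by the
limit before analyticity is claimed. -/
theorem meromorphicAt_of_bounded {f : ℂ → ℂ} {c : ℂ}
    (hd : ∀ᶠ z in 𝓝[≠] c, DifferentiableAt ℂ f z) {C : ℝ} (hb : ∀ᶠ z in 𝓝[≠] c, ‖f z‖ ≤ C) :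
    MeromorphicAt f c ∧ 0 ≤ meromorphicOrderAt f c := by
  have ht := Complex.tendsto_limUnder_of_differentiable_on_punctured_nhds_of_bounded_under hd
    ⟨C + ‖f c‖, eventually_map.2 (hb.mono fun z hz => norm_sub_le_of_le hz le_rfl)⟩
  set l := limUnder (𝓝[≠] c) f
  have hu : Function.update f c l =ᶠ[𝓝[≠] c] f := by
    filter_upwards [self_mem_nhdsWithin] with z hz
    exact Function.update_of_ne hz _ _
  have ha : AnalyticAt ℂ (Function.update f c l) c := by
    refine Complex.analyticAt_of_differentiable_on_punctured_nhds_of_continuousAt ?_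
      (continuousAt_update_same.2 ht)
    filter_upwards [hd, self_mem_nhdsWithin] with z hz hzc
    refine hz.congr_of_eventuallyEq ?_
    filter_upwards [isOpen_compl_singleton.mem_nhds hzc] with y hy
    exact Function.update_of_ne hy _ _
  exact ⟨ha.meromorphicAt.congr hu, by rw [← meromorphicOrderAt_congr hu]; exact ha.meromorphicOrderAt_nonneg⟩

theorem MeromorphicAt.exists_norm_le {f : ℂ → ℂ} {c : ℂ} (hf : MeromorphicAt f c)
    (h : 0 ≤ meromorphicOrderAt f c) : ∃ C : ℝ, ∀ᶠ z in 𝓝[≠] c, ‖f z‖ ≤ C := by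
  obtain ⟨l, hl⟩ := (tendsto_nhds_iff_meromorphicOrderAt_nonneg hf).2 h
  refine ⟨‖l‖ + 1, ?_⟩
  exact (hl.norm.eventually (gt_mem_nhds (lt_add_one _))).mono fun z hz => le_of_lt hz

/-- An entire function that is `O(z ^ (k - 1))` at infinity is a polynomial of degree `< k`. -/
theorem Differentiable.exists_polynomial_of_growth (k : ℕ) {f : ℂ → ℂ} (hf : Differentiable ℂ f)
    {C : ℝ} (h : ∀ᶠ z in Bornology.cobounded ℂ, ‖f z‖ * ‖z‖ ≤ C * ‖z‖ ^ k) :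
    ∃ P ∈ degreeLT ℂ k, ∀ z, f z = P.eval z := by
  induction k generalizing f C with
  | zero =>
    refine ⟨0, Submodule.zero_mem _, fun z => ?_⟩
    -- With `k = 0` the growth bound says that `f` decays like `1 / z`, and Liouville's theorem
    -- gives `f = 0`.
    have ht : Tendsto f (cocompact ℂ) (𝓝 0) := by
      rw [← Metric.cobounded_eq_cocompact]
      have h2 : Tendsto (fun z : ℂ => C * ‖z‖⁻¹) (Bornology.cobounded ℂ) (𝓝 0) := by
        simpa using (tendsto_inv_atTop_zero.comp (tendsto_norm_cobounded_atTop (E := ℂ))).const_mul C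
      refine squeeze_zero_norm' ?_ h2
      filter_upwards [h, (tendsto_norm_cobounded_atTop (E := ℂ)).eventually_gt_atTop 0] with z hz hz0
      rw [← div_eq_mul_inv, le_div_iff₀ hz0]
      simpa using hz
    simpa using hf.apply_eq_of_tendsto_cocompact z ht
  | succ k ih =>
    -- The quotient `(f z - f 0) / z` is again entire and satisfies the bound with the exponent
    -- lowered by one.
    have hg : Differentiable ℂ (dslope f 0) := by
      rw [← differentiableOn_univ] at hf ⊢
      exact (Complex.differentiableOn_dslope univ_mem).2 hf
    have key : ∀ z, z * dslope f 0 z = f z - f 0 := fun z => by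
      simpa using sub_smul_dslope f 0 z
    obtain ⟨P, hP, hfP⟩ := ih hg (C := C + ‖f 0‖) (by
      have h1 : ∀ᶠ z in Bornology.cobounded ℂ, (1 : ℝ) ≤ ‖z‖ :=
        (tendsto_norm_cobounded_atTop (E := ℂ)).eventually_ge_atTop 1
      filter_upwards [h, h1] with z hz hz1
      have hz0 : 0 < ‖z‖ := by linarith
      have : ‖f z‖ ≤ C * ‖z‖ ^ k := by
        rw [pow_succ, ← mul_assoc] at hz
        exact le_of_mul_le_mul_right hz hz0
      calc ‖dslope f 0 z‖ * ‖z‖ = ‖f z - f 0‖ := by rw [← key z, norm_mul, mul_comm]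
        _ ≤ ‖f z‖ + ‖f 0‖ := norm_sub_le _ _
        _ ≤ C * ‖z‖ ^ k + ‖f 0‖ * ‖z‖ ^ k := by
            gcongr
            exact le_mul_of_one_le_right (norm_nonneg _) (one_le_pow₀ hz1)
        _ = _ := by ring)
    refine ⟨Polynomial.C (f 0) + X * P, ?_, fun z => ?_⟩
    · rw [mem_degreeLT] at hP ⊢
      refine (degree_add_le _ _).trans_lt (max_lt (degree_C_le.trans_lt (by exact_mod_cast k.succ_pos)) ?_)
      rw [degree_mul, degree_X, Nat.cast_add, Nat.cast_one, add_comm]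
      by_cases h0 : P = 0
      · simp [h0, WithBot.bot_lt_iff_ne_bot]
      · rw [degree_eq_natDegree h0] at hP ⊢
        have : P.natDegree < k := by exact_mod_cast hP
        exact_mod_cast Nat.add_lt_add_right this 1
    · simp only [eval_add, eval_C, eval_mul, eval_X, ← hfP, key]
      ring

end ComplexAnalysis

/-! ### Meromorphic functions and forms on a Riemann surface -/

namespace RiemannSurface

open Filter Set

variable {X : Type*} [TopologicalSpace X] [ChartedSpace ℂ X]

theorem tendsto_chartAt_symm_nhdsNE (q : X) :
    Tendsto (chartAt ℂ q).symm (𝓝[≠] (chartAt ℂ q q)) (𝓝[≠] q) := by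
  refine tendsto_nhdsWithin_iff.2 ⟨?_, ?_⟩
  · have := (chartAt ℂ q).continuousAt_symm (mem_chart_target ℂ q)
    rw [ContinuousAt, (chartAt ℂ q).left_inv (mem_chart_source ℂ q)] at this
    exact this.mono_left nhdsWithin_le_nhds
  · filter_upwards [self_mem_nhdsWithin, mem_nhdsWithin_of_mem_nhds
      ((chartAt ℂ q).open_target.mem_nhds (mem_chart_target ℂ q))] with z hz hzt h
    refine hz ?_
    have h' := congrArg (chartAt ℂ q) h
    rwa [(chartAt ℂ q).right_inv hzt] at h'

theorem tendsto_chartAt_nhdsNE (q : X) :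
    Tendsto (chartAt ℂ q) (𝓝[≠] q) (𝓝[≠] (chartAt ℂ q q)) := by
  refine tendsto_nhdsWithin_iff.2 ⟨?_, ?_⟩
  · exact ((chartAt ℂ q).continuousAt (mem_chart_source ℂ q)).mono_left nhdsWithin_le_nhds
  · filter_upwards [self_mem_nhdsWithin, mem_nhdsWithin_of_mem_nhds
      ((chartAt ℂ q).open_source.mem_nhds (mem_chart_source ℂ q))] with z hz hzt h
    exact hz ((chartAt ℂ q).injOn hzt (mem_chart_source ℂ q) h)

theorem map_chartAt_symm_nhdsNE (q : X) :
    map (chartAt ℂ q).symm (𝓝[≠] (chartAt ℂ q q)) = 𝓝[≠] q := by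
  refine le_antisymm (tendsto_chartAt_symm_nhdsNE q) ?_
  have h := (map_mono (m := (chartAt ℂ q).symm) (tendsto_chartAt_nhdsNE q))
  rw [map_map] at h
  refine le_trans (le_of_eq ?_) h
  conv_lhs => rw [← map_id (f := 𝓝[≠] q)]
  refine Filter.map_congr ?_
  · filter_upwards [mem_nhdsWithin_of_mem_nhds
      ((chartAt ℂ q).open_source.mem_nhds (mem_chart_source ℂ q))] with z hz
    exact ((chartAt ℂ q).left_inv hz).symm

instance nhdsNE_neBot (q : X) : (𝓝[≠] q).NeBot := by
  rw [← map_chartAt_symm_nhdsNE]; infer_instance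

theorem eventually_nhdsNE_iff {q : X} {P : X → Prop} :
    (∀ᶠ x in 𝓝[≠] q, P x) ↔ ∀ᶠ z in 𝓝[≠] (chartAt ℂ q q), P ((chartAt ℂ q).symm z) := by
  rw [← map_chartAt_symm_nhdsNE, eventually_map]

theorem tendsto_nhdsNE_iff {q : X} {Y : Type*} {F : X → Y} {l : Filter Y} :
    Tendsto F (𝓝[≠] q) l ↔ Tendsto (F ∘ (chartAt ℂ q).symm) (𝓝[≠] (chartAt ℂ q q)) l := by
  rw [← map_chartAt_symm_nhdsNE, tendsto_map'_iff]

theorem eventually_nhds_chartAt_symm {q : X} {P : X → Prop} (h : ∀ᶠ x in 𝓝 q, P x) :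
    ∀ᶠ z in 𝓝 (chartAt ℂ q q), P ((chartAt ℂ q).symm z) := by
  have := (chartAt ℂ q).continuousAt_symm (mem_chart_target ℂ q)
  rw [ContinuousAt, (chartAt ℂ q).left_inv (mem_chart_source ℂ q)] at this
  exact this h

/-- Meromorphy at a point, read in the preferred chart. -/
def IsMeromorphicAt (F : X → ℂ) (q : X) : Prop :=
  MeromorphicAt (F ∘ (chartAt ℂ q).symm) (chartAt ℂ q q)

section order

variable {F G : X → ℂ} {q : X}

theorem eventuallyEq_comp_symm (h : F =ᶠ[𝓝[≠] q] G) :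
    F ∘ (chartAt ℂ q).symm =ᶠ[𝓝[≠] (chartAt ℂ q q)] G ∘ (chartAt ℂ q).symm :=
  eventually_nhdsNE_iff.1 h

theorem IsMeromorphicAt.congr (hF : IsMeromorphicAt F q) (h : F =ᶠ[𝓝[≠] q] G) :
    IsMeromorphicAt G q :=
  MeromorphicAt.congr hF (eventuallyEq_comp_symm h)

theorem order_congr (h : F =ᶠ[𝓝[≠] q] G) : order F q = order G q :=
  meromorphicOrderAt_congr (eventuallyEq_comp_symm h)

theorem isMeromorphicAt_const (c : ℂ) (q : X) : IsMeromorphicAt (fun _ => c) q :=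
  MeromorphicAt.const c _

theorem IsMeromorphicAt.mul (hF : IsMeromorphicAt F q) (hG : IsMeromorphicAt G q) :
    IsMeromorphicAt (F * G) q :=
  MeromorphicAt.mul hF hG

theorem IsMeromorphicAt.zpow (hF : IsMeromorphicAt F q) (n : ℤ) : IsMeromorphicAt (F ^ n) q :=
  MeromorphicAt.zpow hF n

theorem order_mul (hF : IsMeromorphicAt F q) (hG : IsMeromorphicAt G q) :
    order (F * G) q = order F q + order G q :=
  meromorphicOrderAt_mul hF hG

theorem order_zpow (hF : IsMeromorphicAt F q) (n : ℤ) : order (F ^ n) q = n * order F q :=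
  meromorphicOrderAt_zpow hF

theorem IsMeromorphicAt.prod {ι : Type*} {s : Finset ι} {F : ι → X → ℂ}
    (h : ∀ i ∈ s, IsMeromorphicAt (F i) q) : IsMeromorphicAt (∏ i ∈ s, F i) q := by
  classical
  induction s using Finset.induction_on with
  | empty => exact isMeromorphicAt_const 1 q
  | insert a s ha ih =>
    rw [Finset.prod_insert ha]
    exact (h a (s.mem_insert_self a)).mul (ih fun i hi => h i (Finset.mem_insert_of_mem hi))

theorem order_prod {ι : Type*} {s : Finset ι} {F : ι → X → ℂ}
    (h : ∀ i ∈ s, IsMeromorphicAt (F i) q) :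
    order (∏ i ∈ s, F i) q = ∑ i ∈ s, order (F i) q := by
  classical
  induction s using Finset.induction_on with
  | empty =>
    simp only [Finset.prod_empty, Finset.sum_empty]
    change meromorphicOrderAt (fun _ => (1 : ℂ)) _ = 0
    rw [meromorphicOrderAt_const]; simp
  | insert a s ha ih =>
    have h' : ∀ i ∈ s, IsMeromorphicAt (F i) q := fun i hi => h i (Finset.mem_insert_of_mem hi)
    rw [Finset.prod_insert ha, Finset.sum_insert ha, ← ih h',
      order_mul (h a (s.mem_insert_self a)) (.prod h')]

theorem order_eq_zero_of_tendsto (hF : IsMeromorphicAt F q) {c : ℂ} (hc : c ≠ 0)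
    (h : Tendsto F (𝓝[≠] q) (𝓝 c)) : order F q = 0 :=
  (tendsto_ne_zero_iff_meromorphicOrderAt_eq_zero hF).1 ⟨c, hc, tendsto_nhdsNE_iff.1 h⟩

theorem exists_tendsto_of_order_eq_zero (hF : IsMeromorphicAt F q) (h : order F q = 0) :
    ∃ c ≠ 0, Tendsto F (𝓝[≠] q) (𝓝 c) := by
  obtain ⟨c, hc, h⟩ := (tendsto_ne_zero_iff_meromorphicOrderAt_eq_zero hF).2 h
  exact ⟨c, hc, tendsto_nhdsNE_iff.2 h⟩

theorem IsMeromorphicAt.exists_norm_le (hF : IsMeromorphicAt F q) (h : 0 ≤ order F q) :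
    ∃ C : ℝ, ∀ᶠ x in 𝓝[≠] q, ‖F x‖ ≤ C := by
  obtain ⟨C, hC⟩ := MeromorphicAt.exists_norm_le hF h
  exact ⟨C, eventually_nhdsNE_iff.2 hC⟩

end order

theorem chartAt_target_mem_nhds (q : X) : (chartAt ℂ q).target ∈ 𝓝 (chartAt ℂ q q) :=
  (chartAt ℂ q).open_target.mem_nhds (mem_chart_target ℂ q)

theorem eventually_differentiableAt_of_isMeromorphicAt {F : X → ℂ} {q : X}
    (hF : IsMeromorphicAt F q) :
    ∀ᶠ z in 𝓝[≠] (chartAt ℂ q q), DifferentiableAt ℂ (F ∘ (chartAt ℂ q).symm) z :=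
  (MeromorphicAt.eventually_analyticAt hF).mono fun _ h => h.differentiableAt

/-- The function whose value at each point is the limit of `F` there. -/
def regularize (F : X → ℂ) (q : X) : ℂ := limUnder (𝓝[≠] q) F

/-- At points near `q` but distinct from it a meromorphic function is analytic, hence continuous,
and so equals its own limit. -/
theorem regularize_eventuallyEq {F : X → ℂ} {q : X} (hF : IsMeromorphicAt F q) : regularize F =ᶠ[𝓝[≠] q] F := by
  rw [EventuallyEq, eventually_nhdsNE_iff]
  filter_upwards [eventually_differentiableAt_of_isMeromorphicAt hF, mem_nhdsWithin_of_mem_nhds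
    (chartAt_target_mem_nhds q)] with z hz hzt
  set y := (chartAt ℂ q).symm z with hy
  have hys : y ∈ (chartAt ℂ q).source := (chartAt ℂ q).map_target hzt
  have hc : ContinuousAt F y := by
    rw [(chartAt ℂ q).symm.continuousAt_iff_continuousAt_comp_right (x := y) hys]
    simpa [hy, (chartAt ℂ q).right_inv hzt] using hz.continuousAt
  exact Tendsto.limUnder_eq (hc.mono_left nhdsWithin_le_nhds)

/-- The coordinate vector field of the chart at `q`. -/
def chartVector (q : X) (z : ℂ) : ℂ := mfderiv 𝓘(ℂ) 𝓘(ℂ) (chartAt ℂ q).symm z (1 : ℂ)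

/-- The value of a one-form on the unit tangent vector. -/
def OneForm.val (η : OneForm X) (q : X) : ℂ := η q (1 : ℂ)

/-- Cotangent spaces are one-dimensional, so the chart enters only through a scalar factor. This
factor cancels in quotients of forms. -/
theorem OneForm.coeff_eq (η : OneForm X) (q : X) (z : ℂ) :
    η.coeff q z = chartVector q z * η.val ((chartAt ℂ q).symm z) := by
  have h := (η ((chartAt ℂ q).symm z)).map_smul (chartVector q z) (1 : ℂ)
  have h2 : (chartVector q z • (1 : ℂ)) = chartVector q z := mul_one _
  rw [smul_eq_mul] at h
  rw [OneForm.val, ← h]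
  exact congrArg (η ((chartAt ℂ q).symm z)) h2.symm

section manifold

variable [IsManifold 𝓘(ℂ) ω X] {F : X → ℂ} {q : X}

theorem mdifferentiableAt_chartAt_symm (q : X) {z : ℂ} (hz : z ∈ (chartAt ℂ q).target) :
    MDifferentiableAt 𝓘(ℂ) 𝓘(ℂ) (chartAt ℂ q).symm z :=
  mdifferentiableAt_atlas_symm (chart_mem_atlas ℂ q) hz

theorem differentiableAt_comp_symm {z : ℂ} (hz : z ∈ (chartAt ℂ q).target)
    (hF : MDifferentiableAt 𝓘(ℂ) 𝓘(ℂ) F ((chartAt ℂ q).symm z)) :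
    DifferentiableAt ℂ (F ∘ (chartAt ℂ q).symm) z :=
  mdifferentiableAt_iff_differentiableAt.1 (hF.comp z (mdifferentiableAt_chartAt_symm q hz))

theorem analyticAt_comp_symm (hF : ∀ᶠ x in 𝓝 q, MDifferentiableAt 𝓘(ℂ) 𝓘(ℂ) F x) :
    AnalyticAt ℂ (F ∘ (chartAt ℂ q).symm) (chartAt ℂ q q) := by
  rw [Complex.analyticAt_iff_eventually_differentiableAt]
  filter_upwards [eventually_nhds_chartAt_symm hF, chartAt_target_mem_nhds q] with z hz hzt
  exact differentiableAt_comp_symm hzt hz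

theorem eventually_differentiableAt_comp_symm
    (hF : ∀ᶠ x in 𝓝[≠] q, MDifferentiableAt 𝓘(ℂ) 𝓘(ℂ) F x) :
    ∀ᶠ z in 𝓝[≠] (chartAt ℂ q q), DifferentiableAt ℂ (F ∘ (chartAt ℂ q).symm) z := by
  filter_upwards [eventually_nhdsNE_iff.1 hF, mem_nhdsWithin_of_mem_nhds
    (chartAt_target_mem_nhds q)] with z hz hzt
  exact differentiableAt_comp_symm hzt hz

theorem isMeromorphicAt_of_mdifferentiableAt
    (hF : ∀ᶠ x in 𝓝 q, MDifferentiableAt 𝓘(ℂ) 𝓘(ℂ) F x) : IsMeromorphicAt F q :=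
  (analyticAt_comp_symm hF).meromorphicAt

theorem order_nonneg_of_mdifferentiableAt
    (hF : ∀ᶠ x in 𝓝 q, MDifferentiableAt 𝓘(ℂ) 𝓘(ℂ) F x) : 0 ≤ order F q :=
  (analyticAt_comp_symm hF).meromorphicOrderAt_nonneg

theorem isMeromorphicAt_of_bounded (hF : ∀ᶠ x in 𝓝[≠] q, MDifferentiableAt 𝓘(ℂ) 𝓘(ℂ) F x)
    {C : ℝ} (hC : ∀ᶠ x in 𝓝[≠] q, ‖F x‖ ≤ C) : IsMeromorphicAt F q ∧ 0 ≤ order F q :=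
  meromorphicAt_of_bounded (eventually_differentiableAt_comp_symm hF) (eventually_nhdsNE_iff.1 hC)

theorem mdifferentiableAt_of_comp_symm
    (hF : DifferentiableAt ℂ (F ∘ (chartAt ℂ q).symm) (chartAt ℂ q q)) :
    MDifferentiableAt 𝓘(ℂ) 𝓘(ℂ) F q := by
  have h1 : MDifferentiableAt 𝓘(ℂ) 𝓘(ℂ) (chartAt ℂ q) q :=
    mdifferentiableAt_atlas (chart_mem_atlas ℂ q) (mem_chart_source ℂ q)
  refine ((mdifferentiableAt_iff_differentiableAt.2 hF).comp q h1).congr_of_eventuallyEq ?_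
  filter_upwards [(chartAt ℂ q).open_source.mem_nhds (mem_chart_source ℂ q)] with x hx
  simp [(chartAt ℂ q).left_inv hx]

theorem mdifferentiableAt_regularize (hF : IsMeromorphicAt F q) (h : 0 ≤ order F q) :
    MDifferentiableAt 𝓘(ℂ) 𝓘(ℂ) (regularize F) q := by
  obtain ⟨g, hg, hFg⟩ := (MeromorphicAt.meromorphicOrderAt_nonneg_iff hF).1 h
  apply mdifferentiableAt_of_comp_symm
  refine hg.differentiableAt.congr_of_eventuallyEq ?_
  have h1 : regularize F q = g (chartAt ℂ q q) := by
    refine Tendsto.limUnder_eq (tendsto_nhdsNE_iff.2 ?_)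
    exact (hg.continuousAt.mono_left nhdsWithin_le_nhds).congr' hFg.symm
  have h2 := (eventuallyEq_comp_symm (regularize_eventuallyEq hF)).trans hFg
  have h3 := eventually_nhdsWithin_iff.1 h2
  filter_upwards [h3] with z hz
  by_cases hz0 : z = chartAt ℂ q q
  · rw [hz0, Function.comp_apply, (chartAt ℂ q).left_inv (mem_chart_source ℂ q), h1]
  · exact hz hz0

/-- A meromorphic function without poles on a compact connected surface is constant. -/
theorem exists_eventuallyEq_const [CompactSpace X] [ConnectedSpace X] (hF : IsMeromorphic F)
    (h : ∀ q, 0 ≤ order F q) : ∃ c : ℂ, ∀ q, F =ᶠ[𝓝[≠] q] fun _ => c := by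
  have : MDifferentiable 𝓘(ℂ) 𝓘(ℂ) (regularize F) :=
    fun q => mdifferentiableAt_regularize (hF q) (h q)
  obtain ⟨c, hc⟩ := this.exists_eq_const_of_compactSpace
  refine ⟨c, fun q => ?_⟩
  filter_upwards [regularize_eventuallyEq (hF q)] with x hx
  rw [← hx, hc, Function.const_apply]

/-- The function is constant, and order zero at one point excludes the constant `0`. This plays the
part of the theorem that principal divisors have degree zero. -/
theorem order_eq_zero_of_nonneg [CompactSpace X] [ConnectedSpace X] (hF : IsMeromorphic F)
    (h : ∀ q, 0 ≤ order F q) (q₀ : X) (h₀ : order F q₀ = 0) (q : X) : order F q = 0 := by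
  obtain ⟨c, hc⟩ := exists_eventuallyEq_const hF h
  have key : ∀ q, order F q = if c = 0 then ⊤ else 0 := fun q => by
    rw [order_congr (hc q)]
    exact meromorphicOrderAt_const _ _
  rw [key] at h₀ ⊢
  exact h₀

/-! ### One-forms -/

theorem chartVector_ne_zero (q : X) {z : ℂ} (hz : z ∈ (chartAt ℂ q).target) :
    chartVector q z ≠ 0 := by
  have h := (mdifferentiable_chart (I := 𝓘(ℂ)) q).symm.mfderiv_injective hz
  intro h0
  have h1 : (1 : ℂ) = 0 := h (h0.trans (map_zero (mfderiv 𝓘(ℂ) 𝓘(ℂ) (chartAt ℂ q).symm z)).symm)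
  exact one_ne_zero h1

/-- The differential of a function. -/
def differential (F : X → ℂ) : OneForm X := fun q => mfderiv 𝓘(ℂ) 𝓘(ℂ) F q

theorem coeff_differential {z : ℂ} (hz : z ∈ (chartAt ℂ q).target)
    (hF : MDifferentiableAt 𝓘(ℂ) 𝓘(ℂ) F ((chartAt ℂ q).symm z)) :
    (differential F).coeff q z = deriv (F ∘ (chartAt ℂ q).symm) z := by
  have h := mfderiv_comp z hF (mdifferentiableAt_chartAt_symm q hz)
  rw [mfderiv_eq_fderiv] at h
  rw [← fderiv_apply_one_eq_deriv]
  exact (DFunLike.congr_fun h (1 : ℂ)).symm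

end manifold

end RiemannSurface

namespace RiemannSurface

open Filter Set

variable {X : Type*} [TopologicalSpace X] [ChartedSpace ℂ X] [IsManifold 𝓘(ℂ) ω X]
  {F : X → ℂ} {q : X}

/-- A function tending to `0` at `q` which is injective and holomorphic on a punctured neighbourhood
has a simple zero at `q`. -/
theorem order_eq_one_of_injOn (hd : ∀ᶠ x in 𝓝[≠] q, MDifferentiableAt 𝓘(ℂ) 𝓘(ℂ) F x)
    (h0 : Tendsto F (𝓝[≠] q) (𝓝 0)) {s : Set X} (hs : s ∈ 𝓝[≠] q) (hinj : InjOn F s)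
    (hne : ∀ x ∈ s, F x ≠ 0) : IsMeromorphicAt F q ∧ order F q = 1 := by
  set z₀ := chartAt ℂ q q
  set v : ℂ → ℂ := Function.update (F ∘ (chartAt ℂ q).symm) z₀ 0 with hv
  have hvF : v =ᶠ[𝓝[≠] z₀] F ∘ (chartAt ℂ q).symm := by
    filter_upwards [self_mem_nhdsWithin] with z hz
    exact Function.update_of_ne hz _ _
  have hva : AnalyticAt ℂ v z₀ := by
    refine Complex.analyticAt_of_differentiable_on_punctured_nhds_of_continuousAt ?_
      (continuousAt_update_same.2 (tendsto_nhdsNE_iff.1 h0))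
    filter_upwards [eventually_differentiableAt_comp_symm hd, self_mem_nhdsWithin] with z hz hzc
    refine hz.congr_of_eventuallyEq ?_
    filter_upwards [isOpen_compl_singleton.mem_nhds hzc] with y hy
    exact Function.update_of_ne hy _ _
  have hv0 : v z₀ = 0 := Function.update_self _ _ _
  have hT : ∀ᶠ z in 𝓝 z₀, z ≠ z₀ → (z ∈ (chartAt ℂ q).target ∧ (chartAt ℂ q).symm z ∈ s) := by
    have := mem_nhdsWithin_of_mem_nhds (t := {z₀}ᶜ) (chartAt_target_mem_nhds q)
    exact eventually_nhdsWithin_iff.1 (Filter.inter_mem this (eventually_nhdsNE_iff.1 hs))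
  have hvn : ∀ z, (z ≠ z₀ → (z ∈ (chartAt ℂ q).target ∧ (chartAt ℂ q).symm z ∈ s)) →
      z ≠ z₀ → v z ≠ 0 := fun z hz hzz => by
    rw [hv, Function.update_of_ne hzz]
    exact hne _ (hz hzz).2
  -- The filled-in value `0` is not taken by `F` on `s`, so the extension is still injective, and a
  -- zero with nonzero derivative is simple.
  have hvd : deriv v z₀ ≠ 0 := by
    refine hva.deriv_ne_zero_of_injOn hT ?_
    intro a ha b hb hab
    by_cases ha0 : a = z₀
    · by_contra hba
      have hb0 : b ≠ z₀ := fun h => hba (ha0.trans h.symm)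
      exact hvn b hb hb0 (by rw [← hab, ha0, hv0])
    · by_cases hb0 : b = z₀
      · exact absurd (by rw [hab, hb0, hv0]) (hvn a ha ha0)
      · rw [hv, Function.update_of_ne ha0, Function.update_of_ne hb0] at hab
        exact (chartAt ℂ q).symm.injOn (ha ha0).1 (hb hb0).1
          (hinj (ha ha0).2 (hb hb0).2 hab)
  refine ⟨hva.meromorphicAt.congr hvF, ?_⟩
  have h1 := hva.analyticOrderAt_sub_eq_one_of_deriv_ne_zero hvd
  rw [hv0] at h1
  simp only [sub_zero] at h1
  rw [order, ← meromorphicOrderAt_congr hvF, hva.meromorphicOrderAt_eq, h1]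
  rfl

/-- Differentiation lowers a nonzero order by one, at zeros and poles alike. The constant `c` makes
the order nonzero and does not change the differential. -/
theorem order_coeff_differential (hd : ∀ᶠ x in 𝓝[≠] q, MDifferentiableAt 𝓘(ℂ) 𝓘(ℂ) F x)
    {c : ℂ} {k : ℤ} (hk : k ≠ 0) (h : order (fun x => F x - c) q = k) :
    MeromorphicAt ((differential F).coeff q) (chartAt ℂ q q) ∧
      meromorphicOrderAt ((differential F).coeff q) (chartAt ℂ q q) = ↑(k - 1) := by
  -- A function that is not meromorphic has order `0` by convention, so a nonzero order already
  -- certifies meromorphy.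
  have hm : MeromorphicAt ((fun x => F x - c) ∘ (chartAt ℂ q).symm) (chartAt ℂ q q) :=
    meromorphicAt_of_meromorphicOrderAt_ne_zero (by
      unfold order at h; rw [h]; exact_mod_cast hk)
  have hc : deriv ((fun x => F x - c) ∘ (chartAt ℂ q).symm) =ᶠ[𝓝[≠] (chartAt ℂ q q)]
      (differential F).coeff q := by
    filter_upwards [eventually_nhdsNE_iff.1 hd,
      mem_nhdsWithin_of_mem_nhds (chartAt_target_mem_nhds q)] with z hz hzt
    rw [coeff_differential hzt hz]
    exact deriv_sub_const c
  refine ⟨hm.deriv.congr hc, ?_⟩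
  rw [← meromorphicOrderAt_congr hc]
  exact meromorphicOrderAt_deriv_eq_sub_one (by exact_mod_cast hk) h

/-- A holomorphic function is locally a holomorphic function of an injective one. -/
theorem exists_analyticAt_comp {T : X → ℂ} (hF : ∀ᶠ x in 𝓝 q, MDifferentiableAt 𝓘(ℂ) 𝓘(ℂ) F x)
    {s : Set X} (hs : s ∈ 𝓝 q) (hinj : InjOn F s)
    (hT : ∀ᶠ x in 𝓝 q, MDifferentiableAt 𝓘(ℂ) 𝓘(ℂ) T x) :
    ∃ τ : ℂ → ℂ, AnalyticAt ℂ τ (F q) ∧ T =ᶠ[𝓝 q] τ ∘ F := by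
  set z₀ := chartAt ℂ q q
  set ξ := F ∘ (chartAt ℂ q).symm with hξ
  have hξa : AnalyticAt ℂ ξ z₀ := analyticAt_comp_symm hF
  have hξ0 : ξ z₀ = F q := by
    simp [hξ, z₀, (chartAt ℂ q).left_inv (mem_chart_source ℂ q)]
  have hξd : deriv ξ z₀ ≠ 0 := by
    refine hξa.deriv_ne_zero_of_injOn (Filter.inter_mem (chartAt_target_mem_nhds q)
      (eventually_nhds_chartAt_symm hs)) ?_
    intro a ha b hb hab
    exact (chartAt ℂ q).symm.injOn ha.1 hb.1 (hinj ha.2 hb.2 hab)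
  -- Read in the chart, the injective function `F` has nonzero derivative and hence an analytic
  -- local inverse; composing `T` with it gives `τ`.
  set ψ := hξa.hasStrictDerivAt.localInverse _ _ _ hξd
  have hψ : AnalyticAt ℂ ψ (ξ z₀) := hξa.analyticAt_localInverse hξd
  have hleft : ∀ᶠ z in 𝓝 z₀, ψ (ξ z) = z := hξa.hasStrictDerivAt.eventually_left_inverse hξd
  have hψ0 : ψ (ξ z₀) = z₀ := hleft.self_of_nhds
  refine ⟨(T ∘ (chartAt ℂ q).symm) ∘ ψ, ?_, ?_⟩
  · rw [← hξ0]
    refine AnalyticAt.comp ?_ hψ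
    rw [hψ0]
    exact analyticAt_comp_symm hT
  · filter_upwards [((chartAt ℂ q).continuousAt (mem_chart_source ℂ q)).eventually hleft,
      (chartAt ℂ q).open_source.mem_nhds (mem_chart_source ℂ q)] with x hx hxs
    have h1 : ξ (chartAt ℂ q x) = F x := by simp [hξ, (chartAt ℂ q).left_inv hxs]
    rw [h1] at hx
    simp [hx, (chartAt ℂ q).left_inv hxs]

end RiemannSurface

/-! ### The coordinates of a `p`-gonal surface -/

/-- The `eᵢ` are distinct, so `e k` is a simple root and the derivative does not vanish there. Near
a branch point, `y` thus determines `x`. -/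
theorem exists_mem_nhds_injOn_prod_sub {r : ℕ} {e : Fin r → ℂ} (he : Function.Injective e)
    (k : Fin r) : ∃ s ∈ 𝓝 (e k), Set.InjOn (fun x : ℂ => ∏ i, (x - e i)) s := by
  have hf : (fun x : ℂ => ∏ i, (x - e i)) =
      fun x => (x - e k) * ∏ i ∈ Finset.univ.erase k, (x - e i) := by
    ext x
    exact (Finset.mul_prod_erase _ _ (Finset.mem_univ k)).symm
  have hga : Differentiable ℂ (fun x : ℂ => ∏ i ∈ Finset.univ.erase k, (x - e i)) := by fun_prop
  have hd : Differentiable ℂ (fun x : ℂ => ∏ i, (x - e i)) := by fun_prop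
  refine (hd.analyticAt _).exists_mem_nhds_injOn ?_
  have : HasDerivAt (fun x : ℂ => ∏ i, (x - e i)) (1 * (∏ i ∈ Finset.univ.erase k, (e k - e i)) +
      (e k - e k) * deriv (fun x : ℂ => ∏ i ∈ Finset.univ.erase k, (x - e i)) (e k)) (e k) := by
    rw [hf]
    exact ((hasDerivAt_id (e k)).sub_const (e k)).mul (hga (e k)).hasDerivAt
  rw [this.deriv, sub_self, zero_mul, add_zero, one_mul]
  refine Finset.prod_ne_zero_iff.2 fun i hi => sub_ne_zero.2 fun h => ?_
  exact (Finset.mem_erase.1 hi).1 (he h).symm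

namespace PGonalModel

open Filter Set RiemannSurface

variable {X : Type*} [TopologicalSpace X] [ChartedSpace ℂ X]
  {p r : ℕ} {e : Fin r → ℂ} (M : PGonalModel p e X)

/-- The coordinate `x`. -/
def x : X → ℂ := Function.extend M.emb (fun z => z.1.1) (fun _ => (0 : ℂ))

/-- The coordinate `y`. -/
def y : X → ℂ := Function.extend M.emb (fun z => z.1.2) (fun _ => (0 : ℂ))

@[simp] theorem x_emb (z : affineCurve p e) : M.x (M.emb z) = z.1.1 :=
  M.isOpenEmbedding_emb.injective.extend_apply _ _ _

@[simp] theorem y_emb (z : affineCurve p e) : M.y (M.emb z) = z.1.2 :=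
  M.isOpenEmbedding_emb.injective.extend_apply _ _ _

theorem isOpen_range : IsOpen (range M.emb) := M.isOpenEmbedding_emb.isOpen_range

variable {q : X}

theorem y_pow (hq : q ∈ range M.emb) : M.y q ^ p = ∏ i, (M.x q - e i) := by
  obtain ⟨z, rfl⟩ := hq
  rw [x_emb, y_emb]
  exact z.2

theorem eq_of_x_y {q' : X} (hq : q ∈ range M.emb) (hq' : q' ∈ range M.emb) (hx : M.x q = M.x q')
    (hy : M.y q = M.y q') : q = q' := by
  obtain ⟨z, rfl⟩ := hq
  obtain ⟨z', rfl⟩ := hq'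
  simp only [x_emb, y_emb] at hx hy
  exact congrArg M.emb (Subtype.ext (Prod.ext hx hy))

theorem eventually_mem_range (hq : q ∈ range M.emb) : ∀ᶠ q' in 𝓝 q, q' ∈ range M.emb :=
  M.isOpen_range.mem_nhds hq

theorem mdifferentiableAt_x (hq : q ∈ range M.emb) : MDifferentiableAt 𝓘(ℂ) 𝓘(ℂ) M.x q :=
  M.mdifferentiableOn_x.mdifferentiableAt (M.isOpen_range.mem_nhds hq)

theorem mdifferentiableAt_y (hq : q ∈ range M.emb) : MDifferentiableAt 𝓘(ℂ) 𝓘(ℂ) M.y q :=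
  M.mdifferentiableOn_y.mdifferentiableAt (M.isOpen_range.mem_nhds hq)

theorem eventually_nhdsNE_mem_range [T2Space X] (q : X) : ∀ᶠ q' in 𝓝[≠] q, q' ∈ range M.emb := by
  have hc : IsClosed ((range M.emb)ᶜ \ {q}) :=
    (M.finite_compl_range_emb.subset sdiff_subset).isClosed
  have : ((range M.emb)ᶜ \ {q})ᶜ ∈ 𝓝 q := hc.isOpen_compl.mem_nhds (by simp)
  filter_upwards [mem_nhdsWithin_of_mem_nhds this, self_mem_nhdsWithin] with x hx hxq
  by_contra h
  exact hx ⟨h, hxq⟩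

theorem isClosed_affineCurve : IsClosed (affineCurve p e) :=
  isClosed_eq (by fun_prop) (by fun_prop)

/-- By the equation of the curve, a bound on `x` bounds `y`, and the curve is closed in `ℂ × ℂ`. -/
theorem isCompact_setOf_norm_x_le (hp : p ≠ 0) (R : ℝ) :
    IsCompact {q : X | q ∈ range M.emb ∧ ‖M.x q‖ ≤ R} := by
  -- The maximum with `1` ensures that a point with `‖y‖ > B` satisfies `‖y‖ ≤ ‖y‖ ^ p`.
  set B : ℝ := max 1 (∏ i, (R + ‖e i‖))
  have hK : IsCompact {z : affineCurve p e | ‖z.1.1‖ ≤ R} := by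
    have h1 : IsCompact (Metric.closedBall (0 : ℂ) R ×ˢ Metric.closedBall (0 : ℂ) B) :=
      (isCompact_closedBall _ _).prod (isCompact_closedBall _ _)
    refine ((isClosed_affineCurve (p := p) (e := e)).isClosedEmbedding_subtypeVal.isCompact_preimage
      h1).of_isClosed_subset (isClosed_le (by fun_prop) continuous_const) ?_
    intro z hz
    refine ⟨by simpa using hz, ?_⟩
    simp only [mem_ofPred_eq, Metric.mem_closedBall, dist_zero_right] at hz ⊢
    by_contra! h
    have h1 : 1 < ‖z.1.2‖ := (le_max_left _ _).trans_lt h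
    have h2 : ‖z.1.2‖ ≤ ‖z.1.2‖ ^ p := le_self_pow₀ h1.le hp
    have h3 : ‖z.1.2‖ ^ p ≤ ∏ i, (R + ‖e i‖) := by
      rw [← norm_pow, z.2, norm_prod]
      refine Finset.prod_le_prod (fun _ _ => norm_nonneg _) fun i _ => ?_
      exact (norm_sub_le _ _).trans (by gcongr)
    exact absurd (h2.trans h3) (not_le.2 ((le_max_right _ _).trans_lt h))
  convert hK.image M.isOpenEmbedding_emb.continuous using 1
  ext q
  constructor
  · rintro ⟨⟨z, rfl⟩, hz⟩
    exact ⟨z, by simpa using hz, rfl⟩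
  · rintro ⟨z, hz, rfl⟩
    exact ⟨⟨z, rfl⟩, by simpa using hz⟩

/-- Each set `‖x‖ ≤ R` in the affine part is compact, hence closed in `X`, and does not contain the
point at infinity `q`. -/
theorem tendsto_x [T2Space X] (hp : p ≠ 0) (hq : q ∉ range M.emb) :
    Tendsto M.x (𝓝[≠] q) (Bornology.cobounded ℂ) := by
  rw [← tendsto_norm_atTop_iff_cobounded, tendsto_atTop]
  intro R
  have : {q : X | q ∈ range M.emb ∧ ‖M.x q‖ ≤ R}ᶜ ∈ 𝓝 q :=
    (M.isCompact_setOf_norm_x_le hp R).isClosed.isOpen_compl.mem_nhds fun h => hq h.1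
  filter_upwards [mem_nhdsWithin_of_mem_nhds this, M.eventually_nhdsNE_mem_range q] with x hx hxr
  by_contra h
  exact hx ⟨hxr, (not_le.1 h).le⟩

/-- Otherwise `x` would be continuous on a compact space, hence bounded, although it takes every
complex value. -/
theorem exists_notMem_range [CompactSpace X] (hp : p ≠ 0) : ∃ q : X, q ∉ range M.emb := by
  by_contra! h
  have hc : Continuous M.x := continuous_iff_continuousAt.2 fun q =>
    (M.mdifferentiableAt_x (h q)).continuousAt
  obtain ⟨C, hC⟩ := (isCompact_range hc).isBounded.exists_norm_le
  obtain ⟨y, hy⟩ := IsAlgClosed.exists_pow_nat_eq (∏ i, (((|C| + 1 : ℝ) : ℂ) - e i))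
    (Nat.pos_of_ne_zero hp)
  have := hC _ ⟨M.emb ⟨(((|C| + 1 : ℝ) : ℂ), y), hy⟩, rfl⟩
  rw [x_emb, Complex.norm_real, Real.norm_eq_abs] at this
  have h2 := le_abs_self (|C| + 1)
  have h3 := le_abs_self C
  linarith

theorem eventually_nhds_mdifferentiableAt_x (hq : q ∈ range M.emb) :
    ∀ᶠ q' in 𝓝 q, MDifferentiableAt 𝓘(ℂ) 𝓘(ℂ) M.x q' :=
  (M.eventually_mem_range hq).mono fun _ h => M.mdifferentiableAt_x h

theorem eventually_nhds_mdifferentiableAt_y (hq : q ∈ range M.emb) :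
    ∀ᶠ q' in 𝓝 q, MDifferentiableAt 𝓘(ℂ) 𝓘(ℂ) M.y q' :=
  (M.eventually_mem_range hq).mono fun _ h => M.mdifferentiableAt_y h

theorem tendsto_x_self (hq : q ∈ range M.emb) : Tendsto M.x (𝓝[≠] q) (𝓝 (M.x q)) :=
  (M.mdifferentiableAt_x hq).continuousAt.mono_left nhdsWithin_le_nhds

theorem tendsto_y_self (hq : q ∈ range M.emb) : Tendsto M.y (𝓝[≠] q) (𝓝 (M.y q)) :=
  (M.mdifferentiableAt_y hq).continuousAt.mono_left nhdsWithin_le_nhds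

theorem x_ne_of_y_ne (hp : p ≠ 0) (hq : q ∈ range M.emb) (h : M.y q ≠ 0) (i : Fin r) :
    M.x q ≠ e i := fun hi => by
  refine h (pow_eq_zero_iff hp |>.1 ?_)
  rw [M.y_pow hq]
  exact Finset.prod_eq_zero (Finset.mem_univ i) (by rw [hi, sub_self])

/-- Two points with the same `x` have the same `y ^ p`; near a point with `y ≠ 0` they then have the
same `y`. -/
theorem exists_injOn_x (hp : p ≠ 0) (hq : q ∈ range M.emb) (h : M.y q ≠ 0) :
    ∃ s ∈ 𝓝 q, InjOn M.x s := by
  obtain ⟨t, ht, hinj⟩ := exists_mem_nhds_injOn_pow hp h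
  refine ⟨range M.emb ∩ M.y ⁻¹' t, Filter.inter_mem (M.eventually_mem_range hq)
    ((M.mdifferentiableAt_y hq).continuousAt ht), fun a ha b hb hab => ?_⟩
  refine M.eq_of_x_y ha.1 hb.1 hab (hinj ha.2 hb.2 ?_)
  simp only [M.y_pow ha.1, M.y_pow hb.1, hab]

theorem y_eq_zero_of_x_eq {k : Fin r} (hp : p ≠ 0) (hq : q ∈ range M.emb) (hx : M.x q = e k) : M.y q = 0 := by
  by_contra h
  exact M.x_ne_of_y_ne hp hq h k hx

section order

variable [T2Space X]

theorem prod_x_sub_eventuallyEq (q : X) :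
    (∏ i, fun q' => M.x q' - e i) =ᶠ[𝓝[≠] q] M.y ^ (p : ℤ) := by
  filter_upwards [M.eventually_nhdsNE_mem_range q] with a ha
  simp [M.y_pow ha]

theorem tendsto_x_sub (hp : p ≠ 0) (hq : q ∉ range M.emb) (c : ℂ) :
    Tendsto (fun q' => M.x q' - c) (𝓝[≠] q) (Bornology.cobounded ℂ) :=
  (tendsto_sub_const_cobounded c).comp (M.tendsto_x hp hq)

theorem eventually_mdifferentiableAt_x (q : X) :
    ∀ᶠ q' in 𝓝[≠] q, MDifferentiableAt 𝓘(ℂ) 𝓘(ℂ) M.x q' :=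
  (M.eventually_nhdsNE_mem_range q).mono fun _ h => M.mdifferentiableAt_x h

theorem eventually_mdifferentiableAt_y (q : X) :
    ∀ᶠ q' in 𝓝[≠] q, MDifferentiableAt 𝓘(ℂ) 𝓘(ℂ) M.y q' :=
  (M.eventually_nhdsNE_mem_range q).mono fun _ h => M.mdifferentiableAt_y h

theorem tendsto_x_sub_div (hp : p ≠ 0) (hq : q ∉ range M.emb) (a c : ℂ) :
    Tendsto (fun q' => (M.x q' - a) / (M.x q' - c)) (𝓝[≠] q) (𝓝 1) := by
  have h1 : Tendsto (fun q' => 1 + (c - a) * (M.x q' - c)⁻¹) (𝓝[≠] q) (𝓝 1) := by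
    simpa using ((tendsto_inv₀_cobounded.comp (M.tendsto_x_sub hp hq c)).const_mul (c - a)).const_add 1
  refine h1.congr' ?_
  filter_upwards [(M.tendsto_x_sub hp hq c).eventually (Bornology.eventually_ne_cobounded 0)] with q' h
  have h' : M.x q' - c ≠ 0 := h
  field_simp
  ring

end order

variable [IsManifold 𝓘(ℂ) ω X]

theorem isMeromorphicAt_x_sub (hq : q ∈ range M.emb) (c : ℂ) :
    IsMeromorphicAt (fun q => M.x q - c) q :=
  isMeromorphicAt_of_mdifferentiableAt
    ((M.eventually_nhds_mdifferentiableAt_x hq).mono fun _ h => h.sub mdifferentiableAt_const)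

theorem isMeromorphicAt_y (hq : q ∈ range M.emb) : IsMeromorphicAt M.y q :=
  isMeromorphicAt_of_mdifferentiableAt (M.eventually_nhds_mdifferentiableAt_y hq)

theorem order_x_sub_of_ne (hq : q ∈ range M.emb) {c : ℂ} (hc : M.x q ≠ c) :
    order (fun q => M.x q - c) q = 0 :=
  order_eq_zero_of_tendsto (M.isMeromorphicAt_x_sub hq c) (sub_ne_zero.2 hc)
    ((M.tendsto_x_self hq).sub_const c)

theorem order_y_of_ne (hq : q ∈ range M.emb) (h : M.y q ≠ 0) : order M.y q = 0 :=
  order_eq_zero_of_tendsto (M.isMeromorphicAt_y hq) h (M.tendsto_y_self hq)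

end PGonalModel

/-! ### Orders of `x - c`, `y` and `dx` at affine points, branch points and infinity -/

namespace PGonalModel

open Filter Set RiemannSurface

variable {X : Type*} [TopologicalSpace X] [ChartedSpace ℂ X] [T2Space X] [IsManifold 𝓘(ℂ) ω X]
  {p r n : ℕ} {e : Fin r → ℂ} (M : PGonalModel p e X) {q : X}

section affine

theorem order_x_sub_self (hp : p ≠ 0) (hq : q ∈ range M.emb) (h : M.y q ≠ 0) :
    order (fun q' => M.x q' - M.x q) q = 1 := by
  obtain ⟨s, hs, hinj⟩ := M.exists_injOn_x hp hq h
  refine (order_eq_one_of_injOn (s := s \ {q}) ?_ ?_ ?_ ?_ ?_).2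
  · exact (M.eventually_mdifferentiableAt_x q).mono fun _ h => h.sub mdifferentiableAt_const
  · simpa using (M.tendsto_x_self hq).sub_const (M.x q)
  · exact sdiff_mem_nhdsWithin_compl hs _
  · exact fun a ha b hb hab => hinj ha.1 hb.1 (by simpa using hab)
  · exact fun a ha hab => ha.2 (hinj ha.1 (mem_of_mem_nhds hs) (sub_eq_zero.1 hab))

theorem isMeromorphicAt_coeff_dx_of_ne (hp : p ≠ 0) (hq : q ∈ range M.emb) (h : M.y q ≠ 0) :
    MeromorphicAt ((differential M.x).coeff q) (chartAt ℂ q q) ∧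
      meromorphicOrderAt ((differential M.x).coeff q) (chartAt ℂ q q) = 0 :=
  order_coeff_differential (M.eventually_mdifferentiableAt_x q) one_ne_zero
    (M.order_x_sub_self hp hq h)

end affine

section branch

variable {k : Fin r}

theorem order_y_branch (hp : p ≠ 0) (he : Function.Injective e) (hq : q ∈ range M.emb)
    (hx : M.x q = e k) : order M.y q = 1 := by
  obtain ⟨t, ht, hinj⟩ := exists_mem_nhds_injOn_prod_sub he k
  have hy := M.y_eq_zero_of_x_eq hp hq hx
  have hs : range M.emb ∩ M.x ⁻¹' t ∈ 𝓝 q := Filter.inter_mem (M.eventually_mem_range hq)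
    ((M.mdifferentiableAt_x hq).continuousAt (by rwa [hx]))
  have hI : InjOn M.y (range M.emb ∩ M.x ⁻¹' t) := fun a ha b hb hab => by
    refine M.eq_of_x_y ha.1 hb.1 (hinj ha.2 hb.2 ?_) hab
    simp only [← M.y_pow ha.1, ← M.y_pow hb.1, hab]
  refine (order_eq_one_of_injOn (M.eventually_mdifferentiableAt_y q) (by
    simpa [hy] using M.tendsto_y_self hq) (sdiff_mem_nhdsWithin_compl hs {q})
    (hI.mono sdiff_subset) ?_).2
  exact fun a ha h0 => ha.2 (hI ha.1 (mem_of_mem_nhds hs) (h0.trans hy.symm))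

/-- In `y ^ p = ∏ (x - eᵢ)` only the factor with index `k` vanishes at this point, and `y` has a
simple zero. -/
theorem order_x_sub_branch (hp : p ≠ 0) (he : Function.Injective e) (hq : q ∈ range M.emb)
    (hx : M.x q = e k) : order (fun q' => M.x q' - e k) q = p := by
  have h := order_congr (M.prod_x_sub_eventuallyEq q)
  rw [order_prod fun i _ => M.isMeromorphicAt_x_sub hq (e i), order_zpow (M.isMeromorphicAt_y hq),
    M.order_y_branch hp he hq hx, Finset.sum_eq_single k] at h
  · rw [h]; simp
  · exact fun i _ hi => M.order_x_sub_of_ne hq fun h => hi (he (h.symm.trans hx))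
  · simp

theorem coeff_dx_branch (hp : p ≠ 0) (he : Function.Injective e) (hq : q ∈ range M.emb)
    (hx : M.x q = e k) :
    MeromorphicAt ((differential M.x).coeff q) (chartAt ℂ q q) ∧
      meromorphicOrderAt ((differential M.x).coeff q) (chartAt ℂ q q) = ↑((p : ℤ) - 1) :=
  order_coeff_differential (M.eventually_mdifferentiableAt_x q) (by exact_mod_cast hp)
    (M.order_x_sub_branch hp he hq hx)

end branch

section infinity

/-- The quotient `y / (x - c) ^ n` extends holomorphically to the points at infinity, with value
a `p`-th root of unity. -/
theorem exists_tendsto_y_div (hp : p ≠ 0) (hr : r = n * p) (hq : q ∉ range M.emb) (c : ℂ) :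
    IsMeromorphicAt (fun q' => M.y q' / (M.x q' - c) ^ n) q ∧
      ∃ w : ℂ, w ≠ 0 ∧ Tendsto (fun q' => M.y q' / (M.x q' - c) ^ n) (𝓝[≠] q) (𝓝 w) := by
  set W : X → ℂ := fun q' => M.y q' / (M.x q' - c) ^ n with hW
  -- Because `r = n * p`, the power `W ^ p` is the product of the ratios `(x - eᵢ) / (x - c)`, each
  -- tending to `1`.
  have hWp : Tendsto (fun q' => W q' ^ p) (𝓝[≠] q) (𝓝 1) := by
    have : Tendsto (fun q' => ∏ i, (M.x q' - e i) / (M.x q' - c)) (𝓝[≠] q) (𝓝 (∏ _i : Fin r, 1)) :=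
      tendsto_finsetProd _ fun i _ => M.tendsto_x_sub_div hp hq (e i) c
    rw [Finset.prod_const_one] at this
    refine this.congr' ?_
    filter_upwards [M.eventually_nhdsNE_mem_range q] with q' h
    rw [hW]
    simp only [div_pow, M.y_pow h, Finset.prod_div_distrib, Finset.prod_const, Finset.card_univ,
      Fintype.card_fin, ← pow_mul, hr]
  have hne : ∀ᶠ q' in 𝓝[≠] q, M.x q' - c ≠ 0 :=
    (M.tendsto_x_sub hp hq c).eventually (Bornology.eventually_ne_cobounded 0)
  have hd : ∀ᶠ q' in 𝓝[≠] q, MDifferentiableAt 𝓘(ℂ) 𝓘(ℂ) W q' := by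
    filter_upwards [M.eventually_nhdsNE_mem_range q, hne] with q' h h0
    exact (M.mdifferentiableAt_y h).div
      (((M.mdifferentiableAt_x h).sub mdifferentiableAt_const).pow n) (pow_ne_zero n h0)
  have hb : ∀ᶠ q' in 𝓝[≠] q, ‖W q'‖ ≤ 2 := by
    filter_upwards [hWp.norm.eventually (gt_mem_nhds (show ‖(1 : ℂ)‖ < 2 by norm_num))] with q' h
    by_contra! h2
    rw [norm_pow] at h
    have := le_self_pow₀ (show 1 ≤ ‖W q'‖ by linarith) hp
    linarith
  obtain ⟨hm, ho⟩ := isMeromorphicAt_of_bounded hd hb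
  obtain ⟨w, hw⟩ := (tendsto_nhds_iff_meromorphicOrderAt_nonneg hm).2 ho
  have hw' : Tendsto W (𝓝[≠] q) (𝓝 w) := tendsto_nhdsNE_iff.2 hw
  refine ⟨hm, w, ?_, hw'⟩
  rintro rfl
  have := tendsto_nhds_unique (hw'.pow p) hWp
  rw [zero_pow hp] at this
  exact zero_ne_one this

/-- There is no ramification at infinity. Close to `q` the quotient `y / (x - c) ^ n` stays near a
nonzero `w` and its `p`-th power depends only on `x`. So `x` determines `y`, and `1 / (x - c)` is
injective with a simple zero. -/
theorem order_x_sub_infinity (hp : p ≠ 0) (hr : r = n * p) (hq : q ∉ range M.emb) (c : ℂ) :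
    IsMeromorphicAt (fun q' => M.x q' - c) q ∧ order (fun q' => M.x q' - c) q = -1 := by
  obtain ⟨-, w, hw0, hw⟩ := M.exists_tendsto_y_div hp hr hq c
  obtain ⟨t, ht, hinj⟩ := exists_mem_nhds_injOn_pow hp hw0
  have hne : ∀ᶠ q' in 𝓝[≠] q, M.x q' - c ≠ 0 :=
    (M.tendsto_x_sub hp hq c).eventually (Bornology.eventually_ne_cobounded 0)
  have key : IsMeromorphicAt (fun q' => (M.x q' - c)⁻¹) q ∧
      order (fun q' => (M.x q' - c)⁻¹) q = 1 := by
    refine order_eq_one_of_injOn ?_ (tendsto_inv₀_cobounded.comp (M.tendsto_x_sub hp hq c))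
      (Filter.inter_mem (M.eventually_nhdsNE_mem_range q) (Filter.inter_mem hne (hw ht))) ?_ ?_
    · filter_upwards [M.eventually_nhdsNE_mem_range q, hne] with q' h h0
      exact ((M.mdifferentiableAt_x h).sub mdifferentiableAt_const).inv h0
    · rintro a ⟨ha, ha0, hat⟩ b ⟨hb, hb0, hbt⟩ hab
      have hx : M.x a = M.x b := by simpa using hab
      have hpow : M.y a ^ p = M.y b ^ p := by rw [M.y_pow ha, M.y_pow hb, hx]
      refine M.eq_of_x_y ha hb hx ?_
      have := hinj hat hbt (by simp only [div_pow, hpow, hx])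
      simp only [hx] at this
      exact (div_left_inj' (pow_ne_zero n hb0)).1 this
    · exact fun a ha => inv_ne_zero ha.2.1
  have h1 : (fun q' => (M.x q' - c)⁻¹) ^ (-1 : ℤ) = fun q' => M.x q' - c := by
    ext q'; simp
  have h2 := key.1.zpow (-1)
  have h3 := order_zpow key.1 (-1)
  rw [h1] at h2 h3
  refine ⟨h2, h3.trans ?_⟩
  rw [key.2]; rfl

theorem order_y_infinity (hp : p ≠ 0) (hr : r = n * p) (hq : q ∉ range M.emb) :
    IsMeromorphicAt M.y q ∧ order M.y q = ↑(-n : ℤ) := by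
  obtain ⟨hm, w, hw0, hw⟩ := M.exists_tendsto_y_div hp hr hq 0
  obtain ⟨hxm, hxo⟩ := M.order_x_sub_infinity hp hr hq 0
  have hne : ∀ᶠ q' in 𝓝[≠] q, M.x q' - 0 ≠ 0 :=
    (M.tendsto_x_sub hp hq 0).eventually (Bornology.eventually_ne_cobounded 0)
  have h : (fun q' => M.y q' / (M.x q' - 0) ^ n) * (fun q' => M.x q' - 0) ^ (n : ℤ) =ᶠ[𝓝[≠] q]
      M.y := by
    filter_upwards [hne] with q' h0
    simp only [Pi.mul_apply, Pi.pow_apply, zpow_natCast]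
    exact div_mul_cancel₀ _ (pow_ne_zero n h0)
  refine ⟨(hm.mul (hxm.zpow n)).congr h, ?_⟩
  rw [← order_congr h, order_mul hm (hxm.zpow n), order_zpow hxm, hxo,
    order_eq_zero_of_tendsto hm hw0 hw, zero_add]
  change ((n : ℤ) : WithTop ℤ) * ((-1 : ℤ) : WithTop ℤ) = _
  rw [← WithTop.coe_mul, mul_neg_one]

theorem coeff_dx_infinity (hp : p ≠ 0) (hr : r = n * p) (hq : q ∉ range M.emb) :
    MeromorphicAt ((differential M.x).coeff q) (chartAt ℂ q q) ∧
      meromorphicOrderAt ((differential M.x).coeff q) (chartAt ℂ q q) = ↑(-2 : ℤ) :=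
  order_coeff_differential (M.eventually_mdifferentiableAt_x q) (k := -1) (by norm_num)
    (M.order_x_sub_infinity hp hr hq 0).2

end infinity

end PGonalModel

/-! ### Branch points, their divisors, and monomials in the `x - eᵢ` and `y` -/

namespace PGonalModel

open Filter Set RiemannSurface

section branchPoint

variable {X : Type*} [TopologicalSpace X] [ChartedSpace ℂ X]
  {p r : ℕ} {e : Fin r → ℂ} (M : PGonalModel p e X)

/-- The branch point lying over `e i`. -/
def branchPoint (hp : p ≠ 0) (i : Fin r) : X :=
  M.emb ⟨(e i, 0), by
    change (0 : ℂ) ^ p = ∏ j, (e i - e j)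
    rw [zero_pow hp, Finset.prod_eq_zero (Finset.mem_univ i) (sub_self _)]⟩

variable (hp : p ≠ 0)

theorem branchPoint_mem_range (i : Fin r) : M.branchPoint hp i ∈ range M.emb := ⟨_, rfl⟩

theorem x_branchPoint (i : Fin r) : M.x (M.branchPoint hp i) = e i := M.x_emb _

theorem y_branchPoint (i : Fin r) : M.y (M.branchPoint hp i) = 0 := M.y_emb _

theorem branchPoint_injective (he : Function.Injective e) :
    Function.Injective (M.branchPoint hp) := fun i j h => by
  refine he ?_
  rw [← M.x_branchPoint hp i, h, x_branchPoint]

theorem branchSet_eq : M.branchSet = range (M.branchPoint hp) := by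
  ext q
  constructor
  · rintro ⟨⟨z, hz⟩, ⟨i, rfl⟩, rfl⟩
    exact ⟨i, rfl⟩
  · rintro ⟨i, rfl⟩
    exact ⟨_, ⟨i, rfl⟩, rfl⟩

theorem exists_eq_branchPoint {q : X} (hq : q ∈ range M.emb) (hy : M.y q = 0) :
    ∃ k, q = M.branchPoint hp k := by
  have h := M.y_pow hq
  rw [hy, zero_pow hp, eq_comm, Finset.prod_eq_zero_iff] at h
  obtain ⟨k, -, hk⟩ := h
  exact ⟨k, M.eq_of_x_y hq (M.branchPoint_mem_range hp k)
    (by rw [x_branchPoint, sub_eq_zero.1 hk]) (by rw [y_branchPoint, hy])⟩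

/-- The three kinds of points at which orders are computed separately. -/
theorem y_ne_zero_or (q : X) : (q ∈ range M.emb ∧ M.y q ≠ 0) ∨ (∃ k, q = M.branchPoint hp k) ∨
    q ∉ range M.emb := by
  by_cases hq : q ∈ range M.emb
  · by_cases hy : M.y q = 0
    · exact Or.inr (Or.inl (M.exists_eq_branchPoint hp hq hy))
    · exact Or.inl ⟨hq, hy⟩
  · exact Or.inr (Or.inr hq)

theorem eventually_nhdsNE_y_ne_zero [T2Space X] (hp : p ≠ 0) (q : X) :
    ∀ᶠ q' in 𝓝[≠] q, q' ∈ range M.emb ∧ M.y q' ≠ 0 := by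
  have hc : IsClosed (range (M.branchPoint hp) \ {q}) :=
    ((finite_range _).subset sdiff_subset).isClosed
  have : (range (M.branchPoint hp) \ {q})ᶜ ∈ 𝓝 q := hc.isOpen_compl.mem_nhds (by simp)
  filter_upwards [mem_nhdsWithin_of_mem_nhds this, self_mem_nhdsWithin,
    M.eventually_nhdsNE_mem_range q] with x hx hxq hxr
  refine ⟨hxr, fun h => hx ⟨?_, hxq⟩⟩
  obtain ⟨k, hk⟩ := M.exists_eq_branchPoint hp hxr h
  exact ⟨k, hk.symm⟩

/-- The divisor `∑ cᵢ aᵢ`. -/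
def branchDivisor : (Fin r → ℤ) →+ Divisor X where
  toFun c := ∑ k, Finsupp.single (M.branchPoint hp k) (c k)
  map_zero' := by simp
  map_add' c d := by simp [Finset.sum_add_distrib]

theorem branchDivisor_branchPoint (he : Function.Injective e) (c : Fin r → ℤ) (k : Fin r) :
    M.branchDivisor hp c (M.branchPoint hp k) = c k := by
  simp only [branchDivisor, AddMonoidHom.coe_mk, ZeroHom.coe_mk, Finsupp.finsetSum_apply]
  rw [Finset.sum_eq_single k]
  · simp
  · exact fun i _ hi => Finsupp.single_eq_of_ne fun h => hi (M.branchPoint_injective hp he h.symm)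
  · simp

theorem branchDivisor_of_notMem (c : Fin r → ℤ) {q : X} (hq : ∀ k, q ≠ M.branchPoint hp k) :
    M.branchDivisor hp c q = 0 := by
  simp only [branchDivisor, AddMonoidHom.coe_mk, ZeroHom.coe_mk, Finsupp.finsetSum_apply]
  exact Finset.sum_eq_zero fun i _ => Finsupp.single_eq_of_ne (hq i)

theorem branchDivisor_of_y_ne_zero (c : Fin r → ℤ) {q : X} (hy : M.y q ≠ 0) :
    M.branchDivisor hp c q = 0 :=
  M.branchDivisor_of_notMem hp c fun k h => hy (h ▸ M.y_branchPoint hp k)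

theorem branchDivisor_of_notMem_range (c : Fin r → ℤ) {q : X} (hq : q ∉ range M.emb) :
    M.branchDivisor hp c q = 0 :=
  M.branchDivisor_of_notMem hp c fun k h => hq (h ▸ M.branchPoint_mem_range hp k)

theorem exists_branchDivisor_eq (he : Function.Injective e) {D : Divisor X}
    (hD : (D.support : Set X) ⊆ M.branchSet) : ∃ c, D = M.branchDivisor hp c := by
  refine ⟨fun k => D (M.branchPoint hp k), ?_⟩
  ext q
  by_cases h : ∃ k, q = M.branchPoint hp k
  · obtain ⟨k, rfl⟩ := h
    rw [branchDivisor_branchPoint _ _ he]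
  · rw [branchDivisor_of_notMem _ _ _ (by simpa using h)]
    by_contra h0
    have := hD (Finsupp.mem_support_iff.2 h0)
    rw [M.branchSet_eq hp] at this
    obtain ⟨k, hk⟩ := this
    exact h ⟨k, hk.symm⟩

theorem support_branchDivisor_subset (c : Fin r → ℤ) :
    ((M.branchDivisor hp c).support : Set X) ⊆ M.branchSet := by
  intro q hq
  rw [M.branchSet_eq hp]
  by_contra h
  exact Finsupp.mem_support_iff.1 hq
    (M.branchDivisor_of_notMem hp c fun k hk => h ⟨k, hk.symm⟩)

/-- The function `∏ (x - eᵢ) ^ cᵢ * y ^ b`. -/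
def monomial (c : Fin r → ℤ) (b : ℤ) : X → ℂ := (∏ i, (fun q => M.x q - e i) ^ c i) * M.y ^ b

theorem order_monomial_aux {q : X} (c : Fin r → ℤ) (b : ℤ) (o : Fin r → ℤ) (o' : ℤ)
    (hx : ∀ i, IsMeromorphicAt (fun q => M.x q - e i) q ∧ order (fun q => M.x q - e i) q = o i)
    (hy : IsMeromorphicAt M.y q ∧ order M.y q = o') :
    IsMeromorphicAt (M.monomial c b) q ∧
      order (M.monomial c b) q = ((∑ i, c i * o i + b * o' : ℤ) : WithTop ℤ) := by
  have h1 : ∀ i ∈ Finset.univ, IsMeromorphicAt ((fun q => M.x q - e i) ^ c i) q :=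
    fun i _ => (hx i).1.zpow _
  refine ⟨(IsMeromorphicAt.prod h1).mul (hy.1.zpow b), ?_⟩
  rw [monomial, order_mul (.prod h1) (hy.1.zpow b), order_prod h1, order_zpow hy.1, hy.2]
  simp only [order_zpow (hx _).1, (hx _).2]
  rw [WithTop.coe_add, WithTop.coe_sum]
  rfl

end branchPoint

section order

variable {X : Type*} [TopologicalSpace X] [ChartedSpace ℂ X] [IsManifold 𝓘(ℂ) ω X]
  {p r n : ℕ} {e : Fin r → ℂ} (M : PGonalModel p e X) {q : X} (hp : p ≠ 0)

theorem order_monomial_of_y_ne_zero (hp : p ≠ 0) (hq : q ∈ range M.emb) (hy : M.y q ≠ 0) (c : Fin r → ℤ)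
    (b : ℤ) : IsMeromorphicAt (M.monomial c b) q ∧ order (M.monomial c b) q = 0 := by
  have := M.order_monomial_aux (q := q) c b 0 0
    (fun i => ⟨M.isMeromorphicAt_x_sub hq _, M.order_x_sub_of_ne hq (M.x_ne_of_y_ne hp hq hy i)⟩)
    ⟨M.isMeromorphicAt_y hq, M.order_y_of_ne hq hy⟩
  simpa using this

variable [T2Space X]

theorem order_monomial_branchPoint (he : Function.Injective e) (k : Fin r) (c : Fin r → ℤ)
    (b : ℤ) : IsMeromorphicAt (M.monomial c b) (M.branchPoint hp k) ∧
      order (M.monomial c b) (M.branchPoint hp k) = ((p * c k + b : ℤ) : WithTop ℤ) := by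
  have hq := M.branchPoint_mem_range hp k
  have hx := M.x_branchPoint hp k
  have := M.order_monomial_aux (q := M.branchPoint hp k) c b (fun i => if i = k then p else 0) 1
    (fun i => ⟨M.isMeromorphicAt_x_sub hq _, by
      split_ifs with h
      · rw [h, M.order_x_sub_branch hp he hq hx]; rfl
      · rw [M.order_x_sub_of_ne hq fun h' => h (he (h'.symm.trans hx))]; rfl⟩)
    ⟨M.isMeromorphicAt_y hq, M.order_y_branch hp he hq hx⟩
  simpa [mul_comm] using this

theorem order_monomial_infinity (hp : p ≠ 0) (hr : r = n * p) (hq : q ∉ range M.emb) (c : Fin r → ℤ)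
    (b : ℤ) : IsMeromorphicAt (M.monomial c b) q ∧
      order (M.monomial c b) q = ((-(∑ i, c i) - n * b : ℤ) : WithTop ℤ) := by
  have := M.order_monomial_aux (q := q) c b (fun _ => -1) (-n)
    (fun i => M.order_x_sub_infinity hp hr hq _) (M.order_y_infinity hp hr hq)
  convert this using 3
  rw [← Finset.sum_mul]
  ring

/-! ### Principal divisors supported on the branch set -/

/-- Writing `dᵢ = p cᵢ + b`, the monomial `∏ (x - eᵢ) ^ cᵢ * y ^ b` has order `dᵢ` at `aᵢ`. At
infinity its order is `-(∑ cᵢ + n b)`, and `p` times this is `-∑ dᵢ = 0`. -/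
theorem branchDivisor_mem_principalDivisors (hn : 0 < r) (hr : r = n * p)
    (he : Function.Injective e)
    {d : Fin r → ℤ} (hd : ∑ i, d i = 0) (hd' : ∀ i j, (p : ℤ) ∣ d i - d j) :
    M.branchDivisor hp d ∈ principalDivisors X := by
  set b := d ⟨0, hn⟩
  choose c hc using fun i => hd' i ⟨0, hn⟩
  have hsum : ∑ i, c i + n * b = 0 := by
    have h1 : ∑ i, d i = ∑ i, (p * c i + b) := Finset.sum_congr rfl fun i _ => by
      rw [← hc i]; simp [b]
    rw [hd, Finset.sum_add_distrib, ← Finset.mul_sum, Finset.sum_const, Finset.card_univ,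
      Fintype.card_fin, nsmul_eq_mul] at h1
    have h2 : (p : ℤ) * (∑ i, c i + n * b) = 0 := by
      rw [h1, show (r : ℤ) = n * p by exact_mod_cast hr]; ring
    exact (mul_eq_zero.1 h2).resolve_left (by exact_mod_cast hp)
  have key : ∀ q, IsMeromorphicAt (M.monomial c b) q ∧
      order (M.monomial c b) q = (M.branchDivisor hp d q : WithTop ℤ) := fun q => by
    rcases M.y_ne_zero_or hp q with ⟨hq, hy⟩ | ⟨k, rfl⟩ | hq
    · rw [M.branchDivisor_of_y_ne_zero hp d hy]
      exact M.order_monomial_of_y_ne_zero hp hq hy c b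
    · rw [M.branchDivisor_branchPoint hp he]
      convert M.order_monomial_branchPoint hp he k c b using 3
      rw [← hc k]; simp [b]
    · rw [M.branchDivisor_of_notMem_range hp d hq]
      convert M.order_monomial_infinity hp hr hq c b using 3
      linarith
  exact ⟨M.monomial c b, fun q => (key q).1, fun q => (key q).2⟩

/-- The function `F ^ p * ∏ (x - eᵢ) ^ (-dᵢ)` has order `0` on the affine part and `∑ dᵢ` at every
point at infinity. If this sum is nonnegative the function is holomorphic, so constant and nonzero.
The opposite sign follows by passing to `-d`. -/
theorem sum_eq_zero_of_nonneg [CompactSpace X] [ConnectedSpace X] (hn : 0 < r) (hr : r = n * p)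
    (he : Function.Injective e) {d : Fin r → ℤ}
    (hd : M.branchDivisor hp d ∈ principalDivisors X) (h0 : 0 ≤ ∑ i, d i) : ∑ i, d i = 0 := by
  obtain ⟨F, hF, hFd⟩ := hd
  have hFm : ∀ q, IsMeromorphicAt F q := hF
  have hnon : ∀ q ∈ range M.emb, IsMeromorphicAt (F ^ (p : ℤ) * M.monomial (-d) 0) q ∧
      order (F ^ (p : ℤ) * M.monomial (-d) 0) q = 0 := fun q hq => by
    by_cases hy : M.y q = 0
    · obtain ⟨k, rfl⟩ := M.exists_eq_branchPoint hp hq hy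
      obtain ⟨h1, h2⟩ := M.order_monomial_branchPoint hp he k (-d) 0
      refine ⟨((hFm _).zpow p).mul h1, ?_⟩
      rw [order_mul ((hFm _).zpow p) h1, h2, order_zpow (hFm _), hFd,
        M.branchDivisor_branchPoint hp he]
      change ((p : ℤ) : WithTop ℤ) * _ + _ = ((0 : ℤ) : WithTop ℤ)
      rw [← WithTop.coe_mul, ← WithTop.coe_add]
      simp
    · obtain ⟨h1, h2⟩ := M.order_monomial_of_y_ne_zero hp hq hy (-d) 0
      refine ⟨((hFm _).zpow p).mul h1, ?_⟩
      rw [order_mul ((hFm _).zpow p) h1, h2, order_zpow (hFm _), hFd,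
        M.branchDivisor_of_y_ne_zero hp d hy]
      simp
  have hinf : ∀ q ∉ range M.emb, IsMeromorphicAt (F ^ (p : ℤ) * M.monomial (-d) 0) q ∧
      order (F ^ (p : ℤ) * M.monomial (-d) 0) q = ((∑ i, d i : ℤ) : WithTop ℤ) := fun q hq => by
    obtain ⟨h1, h2⟩ := M.order_monomial_infinity hp hr hq (-d) 0
    refine ⟨((hFm _).zpow p).mul h1, ?_⟩
    rw [order_mul ((hFm _).zpow p) h1, h2, order_zpow (hFm _), hFd,
      M.branchDivisor_of_notMem_range hp d hq]
    simp
  obtain ⟨q, hq⟩ := M.exists_notMem_range hp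
  have h := order_eq_zero_of_nonneg (F := F ^ (p : ℤ) * M.monomial (-d) 0) (fun q => ?_)
    (fun q => ?_) _ (hnon _ (M.branchPoint_mem_range hp ⟨0, hn⟩)).2 q
  · rw [(hinf q hq).2] at h
    exact_mod_cast h
  · by_cases hq : q ∈ range M.emb
    exacts [(hnon q hq).1, (hinf q hq).1]
  · by_cases hq : q ∈ range M.emb
    · rw [(hnon q hq).2]
    · rw [(hinf q hq).2]; exact_mod_cast h0

theorem sum_eq_zero_of_mem_principalDivisors [CompactSpace X] [ConnectedSpace X] (hn : 0 < r)
    (hr : r = n * p) (he : Function.Injective e) {d : Fin r → ℤ}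
    (hd : M.branchDivisor hp d ∈ principalDivisors X) : ∑ i, d i = 0 := by
  rcases le_total 0 (∑ i, d i) with h | h
  · exact M.sum_eq_zero_of_nonneg hp hn hr he hd h
  · have := M.sum_eq_zero_of_nonneg hp hn hr he (d := -d)
      (by rw [map_neg]; exact neg_mem hd) (by simpa using h)
    simpa using this

end order

end PGonalModel

/-! ### The rotation `y ↦ ζ y` and congruences modulo `p` -/

namespace PGonalModel

open Filter Set RiemannSurface

section deck

variable {X : Type*} [TopologicalSpace X] [ChartedSpace ℂ X]
  {p r : ℕ} {e : Fin r → ℂ} (M : PGonalModel p e X)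

/-- The automorphism `(x, y) ↦ (x, ζ y)` of the affine curve. -/
def affineRotate {ζ : ℂ} (hζ : ζ ^ p = 1) (z : affineCurve p e) : affineCurve p e :=
  ⟨(z.1.1, ζ * z.1.2), by
    change (ζ * z.1.2) ^ p = ∏ i, (z.1.1 - e i)
    rw [mul_pow, hζ, one_mul]
    exact z.2⟩

/-- The automorphism `(x, y) ↦ (x, ζ y)`, extended by the identity to the points at infinity. -/
def rotate {ζ : ℂ} (hζ : ζ ^ p = 1) : X → X :=
  Function.extend M.emb (fun z => M.emb (affineRotate hζ z)) id

variable {ζ : ℂ} (hζ : ζ ^ p = 1) {q : X}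

theorem rotate_emb (z : affineCurve p e) :
    M.rotate hζ (M.emb z) = M.emb (affineRotate hζ z) :=
  M.isOpenEmbedding_emb.injective.extend_apply _ _ _

theorem rotate_mem_range (hq : q ∈ range M.emb) : M.rotate hζ q ∈ range M.emb := by
  obtain ⟨z, rfl⟩ := hq
  exact ⟨_, (M.rotate_emb hζ z).symm⟩

theorem x_rotate (hq : q ∈ range M.emb) : M.x (M.rotate hζ q) = M.x q := by
  obtain ⟨z, rfl⟩ := hq
  rw [rotate_emb, x_emb, x_emb, affineRotate]

theorem y_rotate (hq : q ∈ range M.emb) : M.y (M.rotate hζ q) = ζ * M.y q := by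
  obtain ⟨z, rfl⟩ := hq
  rw [rotate_emb, y_emb, y_emb, affineRotate]

theorem continuousAt_rotate (hq : q ∈ range M.emb) : ContinuousAt (M.rotate hζ) q := by
  obtain ⟨z, rfl⟩ := hq
  rw [← M.isOpenEmbedding_emb.continuousAt_iff]
  have : M.rotate hζ ∘ M.emb = M.emb ∘ affineRotate hζ := funext (M.rotate_emb hζ)
  rw [this]
  refine (M.isOpenEmbedding_emb.continuous.comp ?_).continuousAt
  unfold affineRotate
  fun_prop

theorem rotate_branchPoint (hp : p ≠ 0) (k : Fin r) :
    M.rotate hζ (M.branchPoint hp k) = M.branchPoint hp k :=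
  M.eq_of_x_y (M.rotate_mem_range hζ (M.branchPoint_mem_range hp k)) (M.branchPoint_mem_range hp k)
    (M.x_rotate hζ (M.branchPoint_mem_range hp k)) (by
      rw [M.y_rotate hζ (M.branchPoint_mem_range hp k), y_branchPoint, mul_zero])

theorem tendsto_rotate_branchPoint [T2Space X] (hp : p ≠ 0) (k : Fin r) :
    Tendsto (M.rotate hζ) (𝓝[≠] (M.branchPoint hp k)) (𝓝[≠] (M.branchPoint hp k)) := by
  have hζ0 : ζ ≠ 0 := by rintro rfl; rw [zero_pow hp] at hζ; exact zero_ne_one hζ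
  refine tendsto_nhdsWithin_iff.2 ⟨?_, ?_⟩
  · have := M.continuousAt_rotate hζ (M.branchPoint_mem_range hp k)
    rw [ContinuousAt, M.rotate_branchPoint hζ hp k] at this
    exact this.mono_left nhdsWithin_le_nhds
  · filter_upwards [M.eventually_nhdsNE_y_ne_zero hp (M.branchPoint hp k)] with q hq h
    have h1 := M.y_rotate hζ hq.1
    rw [mem_singleton_iff.1 h, y_branchPoint] at h1
    exact mul_ne_zero hζ0 hq.2 h1.symm

end deck

section congruence

variable {X : Type*} [TopologicalSpace X] [ChartedSpace ℂ X] [T2Space X] [IsManifold 𝓘(ℂ) ω X]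
  {p r n : ℕ} {e : Fin r → ℂ} (M : PGonalModel p e X) {q : X} (hp : p ≠ 0)

/-- If `F` is holomorphic and without zeros off the branch points then `F ∘ rotate / F` is constant;
its value is read off at each branch point. -/
theorem zpow_eq_zpow_of_mem_principalDivisors [CompactSpace X] [ConnectedSpace X]
    {ζ : ℂ} (hζ : ζ ^ p = 1)
    (he : Function.Injective e) {d : Fin r → ℤ}
    (hd : M.branchDivisor hp d ∈ principalDivisors X) (j k : Fin r) : ζ ^ d j = ζ ^ d k := by
  obtain ⟨F, hF, hFd⟩ := hd
  have hζ0 : ζ ≠ 0 := by rintro rfl; rw [zero_pow hp] at hζ; exact zero_ne_one hζ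
  have hFm : ∀ q, IsMeromorphicAt F q := hF
  set G := regularize F with hG
  have hGF : ∀ q, G =ᶠ[𝓝[≠] q] F := fun q => regularize_eventuallyEq (hFm q)
  -- off the branch points `G` is holomorphic and does not vanish
  have hnb : ∀ q, (∀ i, q ≠ M.branchPoint hp i) →
      MDifferentiableAt 𝓘(ℂ) 𝓘(ℂ) G q ∧ G q ≠ 0 := fun q hq => by
    have h0 : order F q = 0 := by rw [hFd, M.branchDivisor_of_notMem hp d hq]; rfl
    refine ⟨mdifferentiableAt_regularize (hFm q) h0.ge, ?_⟩
    obtain ⟨c, hc, ht⟩ := exists_tendsto_of_order_eq_zero (hFm q) h0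
    rwa [hG, regularize, ht.limUnder_eq]
  have hne : ∀ {q : X}, M.y q ≠ 0 → ∀ i, q ≠ M.branchPoint hp i := fun hy i h =>
    hy (h ▸ M.y_branchPoint hp i)
  have hev : ∀ {q : X}, q ∈ range M.emb → M.y q ≠ 0 →
      ∀ᶠ q' in 𝓝 q, q' ∈ range M.emb ∧ M.y q' ≠ 0 := fun hq hy =>
    (M.eventually_mem_range hq).and ((M.mdifferentiableAt_y hq).continuousAt.eventually_ne hy)
  have hyr : ∀ {q : X}, q ∈ range M.emb → M.y q ≠ 0 → M.y (M.rotate hζ q) ≠ 0 := fun hq hy => by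
    rw [M.y_rotate hζ hq]; exact mul_ne_zero hζ0 hy
  set L : X → ℂ := fun q => G (M.rotate hζ q) / G q with hL
  have hLd : ∀ q ∈ range M.emb, M.y q ≠ 0 → MDifferentiableAt 𝓘(ℂ) 𝓘(ℂ) L q := fun q hq hy => by
    have hq1 := M.rotate_mem_range hζ hq
    have hy1 := hyr hq hy
    -- Holomorphy of the rotation is not needed: near the rotated point `G = τ ∘ x`, and `x` is
    -- invariant, so `G ∘ rotate = τ ∘ x` near `q`.
    obtain ⟨s, hs, hinj⟩ := M.exists_injOn_x hp hq1 hy1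
    obtain ⟨τ, hτ, hGτ⟩ := exists_analyticAt_comp (M.eventually_nhds_mdifferentiableAt_x hq1) hs hinj
      ((hev hq1 hy1).mono fun q' h => (hnb q' (hne h.2)).1)
    rw [M.x_rotate hζ hq] at hτ
    have h1 : MDifferentiableAt 𝓘(ℂ) 𝓘(ℂ) (τ ∘ M.x) q :=
      (mdifferentiableAt_iff_differentiableAt.2 hτ.differentiableAt).comp q (M.mdifferentiableAt_x hq)
    have h2 : MDifferentiableAt 𝓘(ℂ) 𝓘(ℂ) (fun q => G (M.rotate hζ q)) q := by
      refine h1.congr_of_eventuallyEq ?_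
      filter_upwards [M.continuousAt_rotate hζ hq hGτ, M.eventually_mem_range hq] with q' h h'
      have h'' : G (M.rotate hζ q') = (τ ∘ M.x) (M.rotate hζ q') := h
      rw [h'', Function.comp_apply, M.x_rotate hζ h', Function.comp_apply]
    exact h2.div (hnb q (hne hy)).1 (hnb q (hne hy)).2
  have hLe : ∀ q, ∀ᶠ q' in 𝓝[≠] q, MDifferentiableAt 𝓘(ℂ) 𝓘(ℂ) L q' := fun q =>
    (M.eventually_nhdsNE_y_ne_zero hp q).mono fun q' h => hLd q' h.1 h.2
  -- the limit at the branch points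
  have hLb : ∀ k, Tendsto L (𝓝[≠] (M.branchPoint hp k)) (𝓝 (ζ ^ d k)) := fun k => by
    set a := M.branchPoint hp k
    have hy1 := M.order_y_branch hp he (M.branchPoint_mem_range hp k) (M.x_branchPoint hp k)
    have hym := M.isMeromorphicAt_y (M.branchPoint_mem_range hp k)
    -- The product `F * y ^ (-d k)` has a nonzero limit `u` at the branch point. The rotation
    -- multiplies `y ^ (-d k)` by `ζ ^ (-d k)`, which leaves the factor `ζ ^ d k` in the limit of
    -- `L`.
    have hUm : IsMeromorphicAt (F * M.y ^ (-d k)) a := (hFm a).mul (hym.zpow _)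
    have hU0 : order (F * M.y ^ (-d k)) a = 0 := by
      rw [order_mul (hFm a) (hym.zpow _), order_zpow hym, hy1, hFd, M.branchDivisor_branchPoint hp he]
      change ((d k : ℤ) : WithTop ℤ) + ((-d k : ℤ) : WithTop ℤ) * ((1 : ℤ) : WithTop ℤ) = (0 : ℤ)
      rw [← WithTop.coe_mul, ← WithTop.coe_add]
      simp
    obtain ⟨u, hu0, hu⟩ := exists_tendsto_of_order_eq_zero hUm hU0
    have hrot := M.tendsto_rotate_branchPoint hζ hp k
    have h1 : Tendsto (fun q => (F * M.y ^ (-d k)) (M.rotate hζ q) / (F * M.y ^ (-d k)) q * ζ ^ d k)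
        (𝓝[≠] a) (𝓝 (u / u * ζ ^ d k)) := ((hu.comp hrot).div hu hu0).mul_const _
    rw [div_self hu0, one_mul] at h1
    refine h1.congr' ?_
    filter_upwards [hGF a, hrot.eventually (hGF a), M.eventually_nhdsNE_y_ne_zero hp a] with q h2 h3 h4
    simp only [hL, h2, h3, Pi.mul_apply, Pi.pow_apply, M.y_rotate hζ h4.1, mul_zpow]
    have hz : ζ ^ (-d k) * ζ ^ d k = 1 := by rw [← zpow_add₀ hζ0]; simp
    have hy : M.y q ^ (-d k) ≠ 0 := zpow_ne_zero _ h4.2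
    calc F (M.rotate hζ q) * (ζ ^ (-d k) * M.y q ^ (-d k)) / (F q * M.y q ^ (-d k)) * ζ ^ d k
        = (F (M.rotate hζ q) * M.y q ^ (-d k)) / (F q * M.y q ^ (-d k)) * (ζ ^ (-d k) * ζ ^ d k) := by
          ring
      _ = _ := by rw [hz, mul_one, mul_div_mul_right _ _ hy]
  -- boundedness at infinity
  have hLi : ∃ C : ℝ, ∀ q ∉ range M.emb, ∀ᶠ q' in 𝓝[≠] q, ‖L q'‖ ≤ C := by
    -- As `R` exceeds every `‖e i‖`, the compact set `K` contains infinity but no branch point, so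
    -- `G` and `1 / G` are bounded on it. It is stable under the rotation, because `x` is. Thus `L`
    -- is bounded near infinity without continuity of the rotation there.
    set R : ℝ := ∑ i, ‖e i‖ + 1
    set K : Set X := {q | q ∈ range M.emb ∧ ‖M.x q‖ < R}ᶜ
    have hK : IsCompact K := by
      refine IsClosed.isCompact (isOpen_iff_mem_nhds.2 fun q hq => ?_).isClosed_compl
      exact (M.eventually_mem_range hq.1).and
        ((M.mdifferentiableAt_x hq.1).continuousAt.norm.eventually (gt_mem_nhds hq.2))
    have hKb : ∀ q ∈ K, ∀ i, q ≠ M.branchPoint hp i := by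
      rintro q hq i rfl
      refine hq ⟨M.branchPoint_mem_range hp i, ?_⟩
      rw [x_branchPoint]
      exact (Finset.single_le_sum (f := fun i => ‖e i‖) (fun _ _ => norm_nonneg _)
        (Finset.mem_univ i)).trans_lt (lt_add_one _)
    have hc : ContinuousOn G K := fun q hq =>
      (hnb q (hKb q hq)).1.continuousAt.continuousWithinAt
    obtain ⟨C, hC⟩ := hK.exists_bound_of_continuousOn hc
    obtain ⟨C', hC'⟩ := hK.exists_bound_of_continuousOn
      (hc.inv₀ fun q hq => (hnb q (hKb q hq)).2)
    refine ⟨C * C', fun q hq => ?_⟩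
    have hx := (tendsto_norm_atTop_iff_cobounded.2 (M.tendsto_x hp hq)).eventually_ge_atTop R
    filter_upwards [hx, M.eventually_nhdsNE_mem_range q] with q' h1 h2
    have hq'K : q' ∈ K := fun h => not_lt.2 h1 h.2
    have hq'K' : M.rotate hζ q' ∈ K := fun h => not_lt.2 h1 (by rw [← M.x_rotate hζ h2]; exact h.2)
    rw [hL]
    simp only [div_eq_mul_inv, norm_mul]
    exact mul_le_mul (hC _ hq'K') (hC' _ hq'K) (norm_nonneg _) ((norm_nonneg _).trans (hC _ hq'K'))
  obtain ⟨C, hC⟩ := hLi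
  have hall : ∀ q, IsMeromorphicAt L q ∧ 0 ≤ order L q := fun q => by
    rcases M.y_ne_zero_or hp q with ⟨hq, hy⟩ | ⟨k, rfl⟩ | hq
    · have h := (hev hq hy).mono fun q' h => hLd q' h.1 h.2
      exact ⟨isMeromorphicAt_of_mdifferentiableAt h, order_nonneg_of_mdifferentiableAt h⟩
    · exact isMeromorphicAt_of_bounded (hLe _) (C := ‖ζ ^ d k‖ + 1)
        (((hLb k).norm.eventually (gt_mem_nhds (lt_add_one _))).mono fun _ h => le_of_lt h)
    · exact isMeromorphicAt_of_bounded (hLe _) (hC q hq)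
  obtain ⟨c, hc⟩ := exists_eventuallyEq_const (fun q => (hall q).1) fun q => (hall q).2
  have key : ∀ k, ζ ^ d k = c := fun k =>
    tendsto_nhds_unique (hLb k) (tendsto_const_nhds.congr' (hc _).symm)
  rw [key, key]

theorem dvd_sub_of_mem_principalDivisors [CompactSpace X] [ConnectedSpace X]
    (he : Function.Injective e) {d : Fin r → ℤ}
    (hd : M.branchDivisor hp d ∈ principalDivisors X) (j k : Fin r) : (p : ℤ) ∣ d j - d k := by
  have hζ := Complex.isPrimitiveRoot_exp p hp
  have h := M.zpow_eq_zpow_of_mem_principalDivisors hp hζ.pow_eq_one he hd j k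
  rw [← hζ.zpow_eq_one_iff_dvd, zpow_sub₀ (Complex.exp_ne_zero _), h]
  exact div_self (zpow_ne_zero _ (Complex.exp_ne_zero _))

theorem branchDivisor_mem_principalDivisors_iff [CompactSpace X] [ConnectedSpace X] (hn : 0 < r)
    (hr : r = n * p) (he : Function.Injective e) {d : Fin r → ℤ} :
    M.branchDivisor hp d ∈ principalDivisors X ↔
      ∑ i, d i = 0 ∧ ∀ i j, (p : ℤ) ∣ d i - d j :=
  ⟨fun h => ⟨M.sum_eq_zero_of_mem_principalDivisors hp hn hr he h,
    M.dvd_sub_of_mem_principalDivisors hp he h⟩,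
    fun h => M.branchDivisor_mem_principalDivisors hp hn hr he h.1 h.2⟩

end congruence

end PGonalModel

/-! ### Counting classes modulo the lattice of principal divisors -/

section counting

open Finset

/-- The image of a fibre of the sum map on `ℤ ^ (k + 2)` modulo the vectors of sum zero whose
coordinates are congruent modulo `p` has `p ^ k` elements. -/
theorem ncard_image_sum_eq {A : Type*} [AddCommGroup A] {k p : ℕ} [NeZero p]
    (φ : (Fin (k + 2) → ℤ) →+ A)
    (hφ : ∀ v, φ v = 0 ↔ ∑ i, v i = 0 ∧ ∀ i j, (p : ℤ) ∣ v i - v j) (hpk : p ∣ k + 2) (d : ℤ) :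
    (φ '' {v | ∑ i, v i = d}).ncard = p ^ k := by
  have heq : ∀ v w, φ v = φ w ↔ ∑ i, (v i - w i) = 0 ∧
      ∀ i j, (p : ℤ) ∣ (v i - w i) - (v j - w j) := fun v w => by
    rw [← sub_eq_zero, ← map_sub, hφ]; rfl
  -- Normal form of a class: coordinate `1` is zero, the last `k` coordinates are residues in `[0,
  -- p)`, and coordinate `0` makes the sum `d`.
  let V : (Fin k → ZMod p) → Fin (k + 2) → ℤ := fun t =>
    Fin.cons (d - ∑ i, ((t i).val : ℤ)) (Fin.cons 0 fun i => ((t i).val : ℤ))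
  have hV0 : ∀ t, V t 0 = d - ∑ i, ((t i).val : ℤ) := fun t => rfl
  have hV1 : ∀ t, V t 1 = 0 := fun t => rfl
  have hV2 : ∀ t (i : Fin k), V t i.succ.succ = (t i).val := fun t i => rfl
  have hVs : ∀ t, ∑ i, V t i = d := fun t => by
    rw [Fin.sum_univ_succ, Fin.sum_univ_succ, Fin.succ_zero_eq_one, hV0, hV1]
    simp [hV2]
  have hinj : Function.Injective fun t => φ (V t) := fun t t' h => by
    funext i
    have h1 := ((heq _ _).1 h).2 i.succ.succ 1
    rw [hV1, hV1, hV2, hV2, sub_self, sub_zero, ← ZMod.intCast_eq_intCast_iff_dvd_sub] at h1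
    simpa using h1.symm
  have hran : φ '' {v | ∑ i, v i = d} = Set.range fun t => φ (V t) := by
    ext a
    constructor
    · rintro ⟨v, hv, rfl⟩
      refine ⟨fun i => ((v i.succ.succ - v 1 : ℤ) : ZMod p), ?_⟩
      set t : Fin k → ZMod p := fun i => ((v i.succ.succ - v 1 : ℤ) : ZMod p) with ht
      change φ (V t) = φ v
      have hv' : ∑ i, v i = d := hv
      have hval : ∀ i, (((t i).val : ℤ) : ZMod p) = ((v i.succ.succ - v 1 : ℤ) : ZMod p) :=
        fun i => by simp [ht]
      have hmod : ∀ i, ((V t i - v i : ℤ) : ZMod p) = ((-v 1 : ℤ) : ZMod p) := by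
        refine Fin.cases ?_ (Fin.cases ?_ fun i => ?_)
        -- For coordinate `0` the prescribed sum gives the difference `(k + 1) * v 1` modulo `p`,
        -- which is `-v 1` because `p ∣ k + 2`.
        · rw [Fin.sum_univ_succ, Fin.sum_univ_succ, Fin.succ_zero_eq_one] at hv'
          rw [hV0, ← hv']
          have hs : ((∑ i, ((t i).val : ℤ) : ℤ) : ZMod p) =
              ((∑ i : Fin k, v i.succ.succ - k * v 1 : ℤ) : ZMod p) := by
            rw [Int.cast_sum]
            simp only [hval]
            rw [← Int.cast_sum]
            simp
          have hk : ((k + 2 : ℕ) : ZMod p) = 0 := (ZMod.natCast_eq_zero_iff _ _).2 hpk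
          push_cast at hs hk ⊢
          rw [hs]
          linear_combination (v 1 : ZMod p) * hk
        · rw [Fin.succ_zero_eq_one, hV1, zero_sub]
        · rw [hV2, Int.cast_sub, hval]; push_cast; ring
      refine (heq _ _).2 ⟨?_, fun i j => ?_⟩
      · rw [Finset.sum_sub_distrib, hVs, hv', sub_self]
      · rw [← ZMod.intCast_eq_intCast_iff_dvd_sub, hmod, hmod]
    · rintro ⟨t, rfl⟩
      exact ⟨V t, hVs t, rfl⟩
  rw [hran, ← Nat.card_coe_set_eq, Nat.card_range_of_injective hinj]
  simp

end counting

/-! ### Quotients of one-forms and uniqueness of the canonical class -/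

namespace RiemannSurface

open Filter Set

variable {X : Type*} [TopologicalSpace X] [ChartedSpace ℂ X]

theorem OneForm.coeff_smul (g : X → ℂ) (η : OneForm X) (q : X) :
    OneForm.coeff (fun q => g q • η q) q = (g ∘ (chartAt ℂ q).symm) * η.coeff q := rfl

variable [IsManifold 𝓘(ℂ) ω X]

theorem OneForm.coeff_div_coeff (η ω₀ : OneForm X) (q : X) :
    (fun q => η.val q / ω₀.val q) ∘ (chartAt ℂ q).symm =ᶠ[𝓝 (chartAt ℂ q q)]
      η.coeff q / ω₀.coeff q := by
  filter_upwards [chartAt_target_mem_nhds q] with z hz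
  rw [Pi.div_apply, OneForm.coeff_eq, OneForm.coeff_eq, Function.comp_apply,
    mul_div_mul_left _ _ (chartVector_ne_zero q hz)]

/-- Any two canonical divisors are linearly equivalent. -/
theorem IsCanonical.sub_mem_principalDivisors {K K' : Divisor X} (hK : IsCanonical K)
    (hK' : IsCanonical K') : K - K' ∈ principalDivisors X := by
  obtain ⟨η, hη⟩ := hK
  obtain ⟨ω₀, hω⟩ := hK'
  refine ⟨fun q => η.val q / ω₀.val q, fun q => ?_, fun q => ?_⟩
  · exact ((hη q).1.div (hω q).1).congr
      ((OneForm.coeff_div_coeff η ω₀ q).filter_mono nhdsWithin_le_nhds).symm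
  · rw [order, meromorphicOrderAt_congr
      ((OneForm.coeff_div_coeff η ω₀ q).filter_mono nhdsWithin_le_nhds),
      div_eq_mul_inv, meromorphicOrderAt_mul (hη q).1 (hω q).1.inv, meromorphicOrderAt_inv,
      (hη q).2, (hω q).2]
    rfl

end RiemannSurface

/-! ### A canonical divisor on the branch set and the number of spin structures -/

namespace PGonalModel

open Filter Set RiemannSurface

variable {X : Type*} [TopologicalSpace X] [ChartedSpace ℂ X] [T2Space X] [IsManifold 𝓘(ℂ) ω X]
  {p r n : ℕ} {e : Fin r → ℂ} (M : PGonalModel p e X) {q : X} (hp : p ≠ 0)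

/-- This is the divisor of `∏ (x - eᵢ) ^ cᵢ * y ^ (1 - p) dx`: the power of `y` cancels the order `p
- 1` of `dx` at the branch points. The order at infinity is `-∑ cᵢ + n (p - 1) - 2 = 0`. -/
theorem isCanonical_branchDivisor (hr : r = n * p) (he : Function.Injective e) {c : Fin r → ℤ}
    (hc : ∑ i, c i = n * (p - 1) - 2) : IsCanonical (M.branchDivisor hp fun i => p * c i) := by
  refine ⟨fun q => M.monomial c (1 - p) q • differential M.x q, fun q => ?_⟩
  have key : ∀ {a b s : ℤ}, IsMeromorphicAt (M.monomial c (1 - p)) q ∧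
      order (M.monomial c (1 - p)) q = (a : WithTop ℤ) →
      MeromorphicAt ((differential M.x).coeff q) (chartAt ℂ q q) ∧
        meromorphicOrderAt ((differential M.x).coeff q) (chartAt ℂ q q) = (b : WithTop ℤ) →
      a + b = s → MeromorphicAt (OneForm.coeff (fun q => M.monomial c (1 - p) q • differential M.x q)
        q) (chartAt ℂ q q) ∧ meromorphicOrderAt (OneForm.coeff (fun q => M.monomial c (1 - p) q •
          differential M.x q) q) (chartAt ℂ q q) = (s : WithTop ℤ) := by
    rintro a b s ⟨h1, h2⟩ ⟨h3, h4⟩ rfl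
    rw [OneForm.coeff_smul]
    refine ⟨MeromorphicAt.mul h1 h3, ?_⟩
    rw [meromorphicOrderAt_mul h1 h3, h4]
    unfold order at h2
    rw [h2]
    rfl
  rcases M.y_ne_zero_or hp q with ⟨hq, hy⟩ | ⟨k, rfl⟩ | hq
  · rw [M.branchDivisor_of_y_ne_zero hp _ hy]
    exact key (a := 0) (M.order_monomial_of_y_ne_zero hp hq hy c _)
      (M.isMeromorphicAt_coeff_dx_of_ne hp hq hy) (add_zero 0)
  · rw [M.branchDivisor_branchPoint hp he]
    exact key (M.order_monomial_branchPoint hp he k c _)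
      (M.coeff_dx_branch hp he (M.branchPoint_mem_range hp k) (M.x_branchPoint hp k)) (by ring)
  · rw [M.branchDivisor_of_notMem_range hp _ hq]
    exact key (M.order_monomial_infinity hp hr hq c _) (M.coeff_dx_infinity hp hr hq)
      (by rw [hc]; ring)

/-- The number of `m`-spin structures supported on the branch set, in terms of the degree
`p (n (p - 1) - 2)` of the canonical class. -/
theorem ncard_spin [CompactSpace X] [ConnectedSpace X] {k m : ℕ} {e : Fin (k + 2) → ℂ}
    (M : PGonalModel p e X) (hp : p ≠ 0) (hr : k + 2 = n * p) (he : Function.Injective e)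
    (hm : 0 < m) (hpm : p ∣ m) (hmd : (m : ℤ) ∣ p * (n * (p - 1) - 2)) :
    {c : DivisorClass X | IsSpin m c ∧ IsSupportedOn M.branchSet c}.ncard = p ^ k := by
  have : NeZero p := ⟨hp⟩
  obtain ⟨d, hd⟩ := hmd
  set φ : (Fin (k + 2) → ℤ) →+ DivisorClass X :=
    (QuotientAddGroup.mk' (principalDivisors X)).comp (M.branchDivisor hp) with hφd
  have hφ : ∀ v, φ v = 0 ↔ ∑ i, v i = 0 ∧ ∀ i j, (p : ℤ) ∣ v i - v j := fun v => by
    rw [← M.branchDivisor_mem_principalDivisors_iff hp (Nat.succ_pos _) hr he]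
    exact QuotientAddGroup.eq_zero_iff _
  -- Only the sum of `c₀` matters, so it is concentrated in one coordinate.
  set c₀ : Fin (k + 2) → ℤ := Pi.single 0 (n * (p - 1) - 2 : ℤ)
  have hc₀ : ∑ i, c₀ i = n * (p - 1) - 2 := by simp [c₀]
  have hK₀ := M.isCanonical_branchDivisor hp hr he hc₀
  have hspin : ∀ c : DivisorClass X, IsSpin m c ↔ m • c = φ fun i => p * c₀ i := fun c => by
    constructor
    · rintro ⟨K, hK, h⟩
      rw [h]
      refine (QuotientAddGroup.eq_iff_sub_mem).2 (hK.sub_mem_principalDivisors hK₀)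
    · exact fun h => ⟨_, hK₀, h⟩
  rw [← ncard_image_sum_eq φ hφ ⟨n, by rw [hr, mul_comm]⟩ d]
  congr 1
  obtain ⟨m', rfl⟩ := hpm
  have hsm : ∀ (v : Fin (k + 2) → ℤ) i, ((p * m') • v) i = (p * m' : ℕ) * v i := fun v i => by
    simp
  -- The difference of the two divisors has sum `m (∑ vᵢ - d)`, and all its coordinates are
  -- divisible by `p`; only the condition on the sum remains.
  have key : ∀ v, (p * m') • φ v = (φ fun i => p * c₀ i) ↔ ∑ i, v i = d := fun v => by
    rw [← sub_eq_zero, ← map_nsmul, ← map_sub, hφ]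
    have h1 : ∑ i, ((p * m') • v - fun i => p * c₀ i) i = (p * m' : ℕ) * (∑ i, v i - d) := by
      simp only [Pi.sub_apply, hsm, Finset.sum_sub_distrib, ← Finset.mul_sum, hc₀, hd]
      ring
    rw [h1, mul_eq_zero, sub_eq_zero]
    constructor
    · exact fun h => h.1.resolve_left (by exact_mod_cast hm.ne')
    · refine fun h => ⟨Or.inr h, fun i j => ⟨m' * v i - c₀ i - (m' * v j - c₀ j), ?_⟩⟩
      simp only [Pi.sub_apply, hsm]
      push_cast
      ring
  ext c
  constructor
  · rintro ⟨hs, D, hD, rfl⟩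
    obtain ⟨v, rfl⟩ := M.exists_branchDivisor_eq hp he hD
    exact ⟨v, (key v).1 ((hspin _).1 hs), rfl⟩
  · rintro ⟨v, hv, rfl⟩
    exact ⟨(hspin _).2 ((key v).2 hv), _, M.support_branchDivisor_subset hp v, rfl⟩

end PGonalModel

/-! ### Traces of functions under the projection `x` -/

namespace PGonalModel

open Filter Set RiemannSurface

section trace

variable {X : Type*} [TopologicalSpace X] [ChartedSpace ℂ X]
  {p r n : ℕ} {e : Fin r → ℂ} (M : PGonalModel p e X)

/-- A function on `X`, read on the affine curve in `ℂ × ℂ`. -/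
def onCurve (B : X → ℂ) : ℂ × ℂ → ℂ := Function.extend Subtype.val (B ∘ M.emb) 0

theorem onCurve_apply (B : X → ℂ) (z : affineCurve p e) : M.onCurve B z.1 = B (M.emb z) :=
  Subtype.val_injective.extend_apply _ _ _

theorem onCurve_mk (B : X → ℂ) {t w : ℂ} (h : w ^ p = ∏ i, (t - e i)) :
    M.onCurve B (t, w) = B (M.emb ⟨(t, w), h⟩) :=
  M.onCurve_apply B ⟨(t, w), h⟩

/-- The trace of a function under the projection `x`. -/
def trace (B : X → ℂ) (t : ℂ) : ℂ :=
  ((Polynomial.nthRoots p (∏ i, (t - e i))).map fun w => M.onCurve B (t, w)).sum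

/-- Any root `s` may be used, so it can be chosen continuously where needed and arbitrarily
elsewhere. At `s = 0` the same point is counted `p` times. -/
theorem trace_eq (B : X → ℂ) {ζ : ℂ} (hζ : IsPrimitiveRoot ζ p) {t s : ℂ}
    (hs : s ^ p = ∏ i, (t - e i)) :
    M.trace B t = ∑ k ∈ Finset.range p, M.onCurve B (t, ζ ^ k * s) := by
  rw [trace, hζ.nthRoots_eq hs, Multiset.map_map]
  rfl

theorem pow_mul_pow_eq {ζ : ℂ} (hζ : IsPrimitiveRoot ζ p) (k : ℕ) {s a : ℂ} (hs : s ^ p = a) :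
    (ζ ^ k * s) ^ p = a := by
  rw [mul_pow, ← pow_mul, mul_comm k, pow_mul, hζ.pow_eq_one, one_pow, one_mul, hs]

theorem norm_trace_le (hp : p ≠ 0) (B : X → ℂ) {t : ℂ} {C : ℝ}
    (h : ∀ q ∈ range M.emb, M.x q = t → ‖B q‖ ≤ C) : ‖M.trace B t‖ ≤ p * C := by
  have hζ := Complex.isPrimitiveRoot_exp p hp
  obtain ⟨s, hs⟩ := IsAlgClosed.exists_pow_nat_eq (∏ i, (t - e i)) (Nat.pos_of_ne_zero hp)
  rw [M.trace_eq B hζ hs]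
  refine (norm_sum_le_of_le _ (fun k _ => ?_ : ∀ k ∈ Finset.range p, _ ≤ C)).trans (by simp)
  rw [M.onCurve_mk B (pow_mul_pow_eq hζ k hs)]
  exact h _ ⟨_, rfl⟩ (M.x_emb _)

variable {B : X → ℂ}

theorem tendsto_trace (hp : p ≠ 0) (i : Fin r)
    (hB : Tendsto B (𝓝[≠] (M.branchPoint hp i)) (𝓝 0)) :
    Tendsto (M.trace B) (𝓝[≠] (e i)) (𝓝 0) := by
  have hζ := Complex.isPrimitiveRoot_exp p hp
  choose s hs using fun t : ℂ =>
    IsAlgClosed.exists_pow_nat_eq (∏ i, (t - e i)) (Nat.pos_of_ne_zero hp)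
  have htr : M.trace B = fun t => ∑ k ∈ Finset.range p,
      M.onCurve B (t, Complex.exp (2 * Real.pi * Complex.I / p) ^ k * s t) :=
    funext fun t => M.trace_eq B hζ (hs t)
  rw [htr]
  suffices ∀ k ∈ Finset.range p, Tendsto (fun t => M.onCurve B
      (t, Complex.exp (2 * Real.pi * Complex.I / p) ^ k * s t)) (𝓝[≠] (e i)) (𝓝 0) by
    simpa using tendsto_finsetSum _ this
  intro k _
  set ζ := Complex.exp (2 * Real.pi * Complex.I / p)
  -- The roots are chosen without continuity, but `‖s‖ ^ p` is the norm of the product, which tends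
  -- to `0` at `e i`.
  have hs0 : Tendsto s (𝓝 (e i)) (𝓝 0) := by
    have h1 : Tendsto (fun t => ‖s t‖ ^ p) (𝓝 (e i)) (𝓝 0) := by
      have hc : Continuous fun t : ℂ => ‖∏ i, (t - e i)‖ := by fun_prop
      have := hc.tendsto (e i)
      rw [Finset.prod_eq_zero (Finset.mem_univ i) (sub_self _), norm_zero] at this
      simpa only [← norm_pow, hs] using this
    rw [tendsto_zero_iff_norm_tendsto_zero]
    have h2 : Tendsto (fun t => (‖s t‖ ^ p) ^ ((p : ℝ)⁻¹)) (𝓝 (e i)) (𝓝 (0 ^ ((p : ℝ)⁻¹))) :=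
      h1.rpow_const (Or.inr (by positivity))
    rw [Real.zero_rpow (by positivity)] at h2
    exact h2.congr fun t => Real.pow_rpow_inv_natCast (norm_nonneg _) hp
  have hmap : Tendsto (fun t => M.emb ⟨(t, ζ ^ k * s t), pow_mul_pow_eq hζ k (hs t)⟩) (𝓝[≠] (e i))
      (𝓝[≠] (M.branchPoint hp i)) := by
    refine tendsto_nhdsWithin_iff.2 ⟨?_, ?_⟩
    · refine (M.isOpenEmbedding_emb.continuous.tendsto _).comp ?_
      rw [tendsto_subtype_rng]
      refine Tendsto.mono_left ?_ nhdsWithin_le_nhds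
      exact tendsto_id.prodMk_nhds (by simpa using hs0.const_mul (ζ ^ k))
    · filter_upwards [self_mem_nhdsWithin] with t ht h
      refine ht ?_
      have := congrArg M.x (mem_singleton_iff.1 h)
      rwa [x_emb, x_branchPoint] at this
  refine (hB.comp hmap).congr fun t => ?_
  rw [M.onCurve_mk B (pow_mul_pow_eq hζ k (hs t)), Function.comp_apply]

/-- On each sheet a root continuous at `t₀` gives a section `γ` of `x`. Near `γ t₀` one has `B = τ ∘
x` with `τ` analytic, so `B ∘ γ = τ`. -/
theorem differentiableAt_trace [IsManifold 𝓘(ℂ) ω X] (hp : p ≠ 0) {t₀ : ℂ}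
    (ht₀ : ∏ i, (t₀ - e i) ≠ 0)
    (hB : ∀ q ∈ range M.emb, M.y q ≠ 0 → MDifferentiableAt 𝓘(ℂ) 𝓘(ℂ) B q) :
    DifferentiableAt ℂ (M.trace B) t₀ := by
  have hζ := Complex.isPrimitiveRoot_exp p hp
  obtain ⟨s₀, hs₀⟩ := IsAlgClosed.exists_pow_nat_eq (∏ i, (t₀ - e i)) (Nat.pos_of_ne_zero hp)
  have hs₀0 : s₀ ≠ 0 := by rintro rfl; rw [zero_pow hp] at hs₀; exact ht₀ hs₀.symm
  set s : ℂ → ℂ := fun t => s₀ * ((∏ i, (t - e i)) / ∏ i, (t₀ - e i)) ^ ((p : ℂ)⁻¹) with hsd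
  have hs : ∀ t, s t ^ p = ∏ i, (t - e i) := fun t => by
    rw [hsd]
    simp only [mul_pow, Complex.cpow_nat_inv_pow _ hp, hs₀]
    exact mul_div_cancel₀ _ ht₀
  have hst₀ : s t₀ = s₀ := by simp [hsd, ht₀]
  have hsc : ContinuousAt s t₀ := by
    refine continuousAt_const.mul (ContinuousAt.cpow (by fun_prop) continuousAt_const ?_)
    simp [ht₀]
  have htr : M.trace B = fun t => ∑ k ∈ Finset.range p,
      M.onCurve B (t, Complex.exp (2 * Real.pi * Complex.I / p) ^ k * s t) :=
    funext fun t => M.trace_eq B hζ (hs t)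
  rw [htr]
  refine DifferentiableAt.fun_sum fun k _ => ?_
  set ζ := Complex.exp (2 * Real.pi * Complex.I / p)
  set γ : ℂ → X := fun t => M.emb ⟨(t, ζ ^ k * s t), pow_mul_pow_eq hζ k (hs t)⟩ with hγ
  have hγc : ContinuousAt γ t₀ := by
    refine M.isOpenEmbedding_emb.continuous.continuousAt.comp ?_
    refine tendsto_subtype_rng.2 ?_
    exact continuousAt_id.prodMk (continuousAt_const.mul hsc)
  have hγr : γ t₀ ∈ range M.emb := ⟨_, rfl⟩
  have hγx : ∀ t, M.x (γ t) = t := fun t => M.x_emb _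
  have hγy : M.y (γ t₀) ≠ 0 := by
    rw [hγ, y_emb]
    simp only [hst₀]
    exact mul_ne_zero (pow_ne_zero _ (Complex.exp_ne_zero _)) hs₀0
  obtain ⟨u, hu, hinj⟩ := M.exists_injOn_x hp hγr hγy
  obtain ⟨τ, hτ, hBτ⟩ := exists_analyticAt_comp (M.eventually_nhds_mdifferentiableAt_x hγr) hu hinj
    (((M.eventually_mem_range hγr).and ((M.mdifferentiableAt_y hγr).continuousAt.eventually_ne
      hγy)).mono fun q h => hB q h.1 h.2)
  rw [hγx] at hτ
  refine hτ.differentiableAt.congr_of_eventuallyEq ?_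
  filter_upwards [hγc hBτ] with t ht
  have ht' : B (γ t) = (τ ∘ M.x) (γ t) := ht
  rw [M.onCurve_mk B (pow_mul_pow_eq hζ k (hs t))]
  change B (γ t) = τ t
  rw [ht', Function.comp_apply, hγx]

/-- A function on `X` bounded near each point at infinity is bounded for large `x`. -/
theorem exists_bound_of_bounded_infinity [T2Space X] [CompactSpace X]
    (h : ∀ q ∉ range M.emb, ∃ C : ℝ, ∀ᶠ q' in 𝓝[≠] q, ‖B q'‖ ≤ C) :
    ∃ C R : ℝ, ∀ q ∈ range M.emb, R < ‖M.x q‖ → ‖B q‖ ≤ C := by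
  choose! C hC using h
  -- A common bound for the finitely many points at infinity. What lies outside the interior of `V`
  -- is a compact subset of the affine part, on which `x` is bounded.
  set C' : ℝ := ∑ q ∈ M.finite_compl_range_emb.toFinset, |C q|
  set V : Set X := {q | q ∈ range M.emb → ‖B q‖ ≤ C'}
  have hV : ∀ q ∉ range M.emb, V ∈ 𝓝 q := fun q hq => by
    filter_upwards [eventually_nhdsWithin_iff.1 (hC q hq)] with q' h1 h2
    refine (h1 fun h => hq (by rwa [← mem_singleton_iff.1 h])).trans ((le_abs_self _).trans ?_)
    exact Finset.single_le_sum (f := fun q => |C q|) (fun _ _ => abs_nonneg _) (by simpa using hq)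
  have hK : IsCompact (interior V)ᶜ := isOpen_interior.isClosed_compl.isCompact
  have hKr : ∀ q ∈ (interior V)ᶜ, q ∈ range M.emb := fun q hq => by
    by_contra h
    exact hq (mem_interior_iff_mem_nhds.2 (hV q h))
  obtain ⟨R, hR⟩ := hK.exists_bound_of_continuousOn (f := M.x) fun q hq =>
    (M.mdifferentiableAt_x (hKr q hq)).continuousAt.continuousWithinAt
  refine ⟨C', R, fun q hq hx => ?_⟩
  have : q ∈ interior V := by
    by_contra h
    exact not_le.2 hx (hR q h)
  exact interior_subset this hq

end trace

end PGonalModel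

/-! ### Extension of holomorphic one-forms over isolated points -/

namespace RiemannSurface

open Filter Set

variable {X : Type*} [TopologicalSpace X] [ChartedSpace ℂ X]

theorem eq_zero_of_val_eq_zero {η : OneForm X} (h : ∀ q, η.val q = 0) : η = 0 := by
  funext q
  refine ContinuousLinearMap.ext fun v => ?_
  have h1 := (η q).map_smul (show ℂ from v) (1 : ℂ)
  have h2 : ((show ℂ from v) • (1 : ℂ)) = v := mul_one _
  have h3 : η q v = (show ℂ from v) • η q (1 : ℂ) := by
    rw [← h1]; exact congrArg (η q) h2.symm
  rw [h3]
  have : η q (1 : ℂ) = 0 := h q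
  rw [this, smul_zero]
  rfl

variable [IsManifold 𝓘(ℂ) ω X]

/-- A one-form that is holomorphic on an open set with discrete complement, and meromorphic without
poles elsewhere, extends to a holomorphic one-form. -/
theorem exists_mem_holomorphicForms {U : Set X} (hU : ∀ q, U ∈ 𝓝[≠] q) {η₀ : OneForm X}
    (hreg : ∀ q ∈ U, U ∈ 𝓝 q ∧ AnalyticAt ℂ (η₀.coeff q) (chartAt ℂ q q))
    (hmer : ∀ q, MeromorphicAt (η₀.coeff q) (chartAt ℂ q q) ∧
      0 ≤ meromorphicOrderAt (η₀.coeff q) (chartAt ℂ q q)) :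
    ∃ η ∈ holomorphicForms X, ∀ q ∈ U, η.val q = η₀.val q := by
  classical
  choose g hg hgη using fun q => (hmer q).1.meromorphicOrderAt_nonneg_iff.1 (hmer q).2
  -- At a missing point the value is forced: the coefficient in the chart there must be the limit `g
  -- q (chartAt ℂ q q)`.
  set η : OneForm X := fun q => if q ∈ U then η₀ q else
    (g q (chartAt ℂ q q) / chartVector q (chartAt ℂ q q)) • (ContinuousLinearMap.id ℂ ℂ) with hη
  have hηU : ∀ q ∈ U, η.val q = η₀.val q := fun q hq => by
    have : η q = η₀ q := if_pos hq
    rw [OneForm.val, this, OneForm.val]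
  have hηU' : ∀ q ∉ U, η.val q = g q (chartAt ℂ q q) / chartVector q (chartAt ℂ q q) :=
    fun q hq => by
      have : η q = (g q (chartAt ℂ q q) / chartVector q (chartAt ℂ q q)) •
        (ContinuousLinearMap.id ℂ ℂ) := if_neg hq
      rw [OneForm.val, this]
      exact mul_one _
  refine ⟨η, fun q => ?_, hηU⟩
  by_cases hq : q ∈ U
  · refine (hreg q hq).2.congr ?_
    filter_upwards [eventually_nhds_chartAt_symm (hreg q hq).1] with z hz
    rw [OneForm.coeff_eq, OneForm.coeff_eq, hηU _ hz]
  · refine (hg q).congr ?_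
    filter_upwards [eventually_nhdsWithin_iff.1 (hgη q),
      eventually_nhdsWithin_iff.1 (eventually_nhdsNE_iff.1 (hU q))] with z h1 h2
    by_cases hz : z = chartAt ℂ q q
    · rw [hz, OneForm.coeff_eq, (chartAt ℂ q).left_inv (mem_chart_source ℂ q), hηU' q hq,
        mul_div_cancel₀ _ (chartVector_ne_zero q (mem_chart_target ℂ q))]
    · rw [← h1 hz, OneForm.coeff_eq, OneForm.coeff_eq, hηU _ (h2 hz)]

end RiemannSurface

/-! ### One-forms written as functions times `dx` -/

namespace PGonalModel

open Filter Set RiemannSurface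

variable {X : Type*} [TopologicalSpace X] [ChartedSpace ℂ X]
  {p r n : ℕ} {e : Fin r → ℂ} (M : PGonalModel p e X) {q : X}

/-- The affine curve without the branch points. -/
def regularSet : Set X := {q | q ∈ range M.emb ∧ M.y q ≠ 0}

theorem regularSet_mem_nhds (hq : q ∈ M.regularSet) : M.regularSet ∈ 𝓝 q :=
  (M.eventually_mem_range hq.1).and ((M.mdifferentiableAt_y hq.1).continuousAt.eventually_ne hq.2)

/-- The family of functions `∑ Pⱼ(x) y⁻ʲ`. -/
def polynomialMap (p n : ℕ) {r : ℕ} {e : Fin r → ℂ} (M : PGonalModel p e X) :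
    (∀ j : Fin p, Polynomial.degreeLT ℂ (n * j - 1)) →ₗ[ℂ] (M.regularSet → ℂ) where
  toFun P q := ∑ j, (P j).1.eval (M.x q) * (M.y q ^ (j : ℕ))⁻¹
  map_add' P Q := by
    ext q
    simp [add_mul, Finset.sum_add_distrib]
  map_smul' c P := by
    ext q
    simp [mul_assoc, Finset.mul_sum]

/-- Over a non-branch `t` the `p` values of `y⁻¹` are distinct, so a Vandermonde system forces all
`Pⱼ(t)` to vanish; this holds for infinitely many `t`. -/
theorem polynomialMap_injective (hp : p ≠ 0) : Function.Injective (polynomialMap p n M) := by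
  rw [← LinearMap.ker_eq_bot, LinearMap.ker_eq_bot']
  intro P hP
  have hζ := Complex.isPrimitiveRoot_exp p hp
  set ζ := Complex.exp (2 * Real.pi * Complex.I / p)
  have key : ∀ t, ∏ i, (t - e i) ≠ 0 → ∀ j, (P j).1.eval t = 0 := fun t ht => by
    obtain ⟨s, hs⟩ := IsAlgClosed.exists_pow_nat_eq (∏ i, (t - e i)) (Nat.pos_of_ne_zero hp)
    have hs0 : s ≠ 0 := by rintro rfl; rw [zero_pow hp] at hs; exact ht hs.symm
    have hinj : Function.Injective fun k : Fin p => (ζ ^ (k : ℕ) * s)⁻¹ := fun k l h => by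
      have := mul_right_cancel₀ hs0 (inv_injective h)
      exact Fin.ext (hζ.pow_inj k.2 l.2 this)
    refine congrFun (Matrix.eq_zero_of_forall_index_sum_mul_pow_eq_zero hinj
      (v := fun j => (P j).1.eval t) fun k => ?_)
    have hk := pow_mul_pow_eq hζ k hs
    have := congrFun hP ⟨M.emb ⟨(t, ζ ^ (k : ℕ) * s), hk⟩, ⟨_, rfl⟩, by
      rw [y_emb]; exact mul_ne_zero (pow_ne_zero _ (Complex.exp_ne_zero _)) hs0⟩
    refine Eq.trans (Finset.sum_congr rfl fun i _ => ?_) this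
    simp only [x_emb, y_emb, inv_pow]
  funext j
  refine Subtype.ext (Polynomial.eq_zero_of_infinite_isRoot _ ?_)
  have hfin : (range e).Finite := finite_range e
  refine hfin.infinite_compl.mono fun t ht => key t (Finset.prod_ne_zero_iff.2 fun i _ h => ?_) j
  exact ht ⟨i, (sub_eq_zero.1 h).symm⟩

variable [IsManifold 𝓘(ℂ) ω X]

/-- The coefficient of a one-form with respect to `dx`. -/
def ratio (η : OneForm X) (q : X) : ℂ := η.val q / (differential M.x).val q

/-- The coefficient of a one-form with respect to `dx`, as a function off the branch points. -/
def ratioMap : OneForm X →ₗ[ℂ] (M.regularSet → ℂ) where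
  toFun η q := M.ratio η q
  map_add' η η' := by
    ext q
    exact add_div _ _ _
  map_smul' c η := by
    ext q
    exact mul_div_assoc _ _ _

theorem ratio_comp_symm (η : OneForm X) (q : X) :
    M.ratio η ∘ (chartAt ℂ q).symm =ᶠ[𝓝 (chartAt ℂ q q)]
      η.coeff q / (differential M.x).coeff q :=
  OneForm.coeff_div_coeff _ _ q

/-- A holomorphic `η` has nonnegative order, so `(η / dx) g` has order at least `a - b`. -/
theorem order_ratio_mul {η : OneForm X} (hη : η ∈ holomorphicForms X) {g : X → ℂ} {a b s : ℤ}
    (hg : IsMeromorphicAt g q ∧ order g q = (a : WithTop ℤ))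
    (hx : MeromorphicAt ((differential M.x).coeff q) (chartAt ℂ q q) ∧
      meromorphicOrderAt ((differential M.x).coeff q) (chartAt ℂ q q) = (b : WithTop ℤ))
    (h : s + b ≤ a) :
    IsMeromorphicAt (M.ratio η * g) q ∧ (s : WithTop ℤ) ≤ order (M.ratio η * g) q := by
  have hc := (M.ratio_comp_symm η q).filter_mono (nhdsWithin_le_nhds (s := {chartAt ℂ q q}ᶜ))
  have hm : IsMeromorphicAt (M.ratio η) q := ((hη q).meromorphicAt.div hx.1).congr hc.symm
  refine ⟨hm.mul hg.1, ?_⟩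
  rw [order_mul hm hg.1, hg.2, order, meromorphicOrderAt_congr hc, div_eq_mul_inv,
    meromorphicOrderAt_mul (hη q).meromorphicAt hx.1.inv, meromorphicOrderAt_inv, hx.2]
  have h0 := (hη q).meromorphicOrderAt_nonneg
  cases ho : meromorphicOrderAt (η.coeff q) (chartAt ℂ q q) with
  | top => simp
  | coe o =>
    rw [ho] at h0
    have h0' : (0 : ℤ) ≤ o := by exact_mod_cast h0
    have : ((o : WithTop ℤ) + -(b : WithTop ℤ)) + (a : WithTop ℤ) = ((o + -b + a : ℤ) : WithTop ℤ) :=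
      rfl
    rw [this]
    exact_mod_cast (by omega : s ≤ o + -b + a)

variable [T2Space X]

theorem analyticAt_coeff_dx (hp : p ≠ 0) (hq : q ∈ M.regularSet) :
    AnalyticAt ℂ ((differential M.x).coeff q) (chartAt ℂ q q) ∧
      (differential M.x).coeff q (chartAt ℂ q q) ≠ 0 := by
  have ha : AnalyticAt ℂ ((differential M.x).coeff q) (chartAt ℂ q q) := by
    refine (analyticAt_comp_symm (M.eventually_nhds_mdifferentiableAt_x hq.1)).deriv.congr ?_
    filter_upwards [eventually_nhds_chartAt_symm (M.eventually_nhds_mdifferentiableAt_x hq.1),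
      chartAt_target_mem_nhds q] with z hz hzt
    rw [coeff_differential hzt hz]
  refine ⟨ha, ?_⟩
  have h := (M.isMeromorphicAt_coeff_dx_of_ne hp hq.1 hq.2).2
  obtain ⟨c, hc, ht⟩ := (tendsto_ne_zero_iff_meromorphicOrderAt_eq_zero ha.meromorphicAt).2 h
  rwa [tendsto_nhds_unique (ha.continuousAt.mono_left nhdsWithin_le_nhds) ht]

theorem order_coeff_dx (hp : p ≠ 0) (hr : r = n * p) (he : Function.Injective e) (q : X) :
    MeromorphicAt ((differential M.x).coeff q) (chartAt ℂ q q) ∧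
      meromorphicOrderAt ((differential M.x).coeff q) (chartAt ℂ q q) ≠ ⊤ := by
  rcases M.y_ne_zero_or hp q with ⟨hq, hy⟩ | ⟨k, rfl⟩ | hq
  · refine ⟨(M.isMeromorphicAt_coeff_dx_of_ne hp hq hy).1, ?_⟩
    rw [(M.isMeromorphicAt_coeff_dx_of_ne hp hq hy).2]
    exact WithTop.coe_ne_top (a := (0 : ℤ))
  · have := M.coeff_dx_branch hp he (M.branchPoint_mem_range hp k) (M.x_branchPoint hp k)
    exact ⟨this.1, by rw [this.2]; exact WithTop.coe_ne_top⟩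
  · have := M.coeff_dx_infinity hp hr hq
    exact ⟨this.1, by rw [this.2]; exact WithTop.coe_ne_top⟩

theorem mdifferentiableAt_ratio (hp : p ≠ 0) {η : OneForm X} (hη : η ∈ holomorphicForms X)
    (hq : q ∈ M.regularSet) : MDifferentiableAt 𝓘(ℂ) 𝓘(ℂ) (M.ratio η) q := by
  have h := M.analyticAt_coeff_dx hp hq
  exact mdifferentiableAt_of_comp_symm
    (((hη q).div h.1 h.2).differentiableAt.congr_of_eventuallyEq (M.ratio_comp_symm η q))

/-- The coefficient of `η` in any chart vanishes on a punctured neighbourhood of the centre, hence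
at the centre by continuity. -/
theorem ratioMap_injOn (hp : p ≠ 0) (hr : r = n * p) (he : Function.Injective e)
    {η : OneForm X} (hη : η ∈ holomorphicForms X) (h : M.ratioMap η = 0) : η = 0 := by
  refine eq_zero_of_val_eq_zero fun q => ?_
  have h1 : ∀ᶠ z in 𝓝[≠] (chartAt ℂ q q), η.coeff q z = 0 := by
    obtain ⟨hm, ht⟩ := M.order_coeff_dx hp hr he q
    filter_upwards [(meromorphicOrderAt_ne_top_iff_eventually_ne_zero hm).1 ht,
      eventually_nhdsNE_iff.1 (M.eventually_nhdsNE_y_ne_zero hp q),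
      (M.ratio_comp_symm η q).filter_mono nhdsWithin_le_nhds] with z h1 h2 h3
    have h4 : M.ratio η ((chartAt ℂ q).symm z) = 0 :=
      congrFun h ⟨(chartAt ℂ q).symm z, h2⟩
    rw [Function.comp_apply, h4, Pi.div_apply, eq_comm, div_eq_zero_iff] at h3
    exact h3.resolve_right h1
  have h2 : η.coeff q (chartAt ℂ q q) = 0 :=
    tendsto_nhds_unique ((hη q).continuousAt.mono_left nhdsWithin_le_nhds)
      (tendsto_const_nhds.congr' (EventuallyEq.symm h1))
  rw [OneForm.coeff_eq, (chartAt ℂ q).left_inv (mem_chart_source ℂ q)] at h2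
  exact (mul_eq_zero.1 h2).resolve_left (chartVector_ne_zero q (mem_chart_target ℂ q))

end PGonalModel

/-! ### Polynomial traces, a basis of holomorphic forms, and the genus -/

namespace PGonalModel

open Filter Set RiemannSurface Polynomial

variable {X : Type*} [TopologicalSpace X] [ChartedSpace ℂ X] [T2Space X] [IsManifold 𝓘(ℂ) ω X]
  {p r n : ℕ} {e : Fin r → ℂ} (M : PGonalModel p e X) {q : X}

section trace

variable [CompactSpace X] {η : OneForm X}

/-- The trace of `(η / dx) y ^ (p + j)` is a polynomial. -/
theorem exists_polynomial_trace (hp : p ≠ 0) (hn : 0 < n) (hr : r = n * p)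
    (he : Function.Injective e) (hη : η ∈ holomorphicForms X) (j : ℕ) :
    ∃ Q ∈ degreeLT ℂ (n * (p + j) - 1),
      ∀ t, M.trace (M.ratio η * M.y ^ ((p + j : ℕ) : ℤ)) t = Q.eval t := by
  -- At a branch point `η / dx` has order at least `1 - p`. The additional factor `y ^ p` gives `B`
  -- a zero there, so the trace extends continuously by `0`.
  set B : X → ℂ := M.ratio η * M.y ^ ((p + j : ℕ) : ℤ) with hB
  have hBd : ∀ q ∈ range M.emb, M.y q ≠ 0 → MDifferentiableAt 𝓘(ℂ) 𝓘(ℂ) B q := fun q hq hy => by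
    rw [hB, zpow_natCast]
    exact (M.mdifferentiableAt_ratio hp hη ⟨hq, hy⟩).mul ((M.mdifferentiableAt_y hq).pow _)
  have hB0 : ∀ i, Tendsto B (𝓝[≠] (M.branchPoint hp i)) (𝓝 0) := fun i => by
    have hq := M.branchPoint_mem_range hp i
    have hx := M.x_branchPoint hp i
    have hym := M.isMeromorphicAt_y hq
    obtain ⟨-, ho⟩ := M.order_ratio_mul (q := M.branchPoint hp i) hη (g := M.y ^ ((p + j : ℕ) : ℤ))
      (a := ((p + j : ℕ) : ℤ)) (s := 1) ⟨hym.zpow _, by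
        rw [order_zpow hym, M.order_y_branch hp he hq hx]; exact mul_one _⟩
      (M.coeff_dx_branch hp he hq hx) (by push_cast; omega)
    exact tendsto_nhdsNE_iff.2 (tendsto_zero_of_meromorphicOrderAt_pos
      (lt_of_lt_of_le (WithTop.coe_lt_coe.2 one_pos) ho))
  have htr0 : ∀ i, M.trace B (e i) = 0 := fun i => by
    rw [← norm_le_zero_iff]
    refine (M.norm_trace_le hp (C := 0) _ fun q hq hx => ?_).trans (by simp)
    rw [hB, Pi.mul_apply, Pi.pow_apply, M.y_eq_zero_of_x_eq hp hq hx, zpow_natCast,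
      zero_pow (by omega), mul_zero, norm_zero]
  have hd : Differentiable ℂ (M.trace B) := fun t => by
    by_cases ht : ∏ i, (t - e i) = 0
    · obtain ⟨i, -, hi⟩ := Finset.prod_eq_zero_iff.1 ht
      obtain rfl := sub_eq_zero.1 hi
      refine (Complex.analyticAt_of_differentiable_on_punctured_nhds_of_continuousAt ?_
        ?_).differentiableAt
      · have : ∀ k, ∀ᶠ t in 𝓝[≠] (e i), t - e k ≠ 0 := fun k => by
          by_cases hk : k = i
          · subst hk
            filter_upwards [self_mem_nhdsWithin] with t ht h using ht (sub_eq_zero.1 h)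
          · have : e i ≠ e k := fun h => hk (he h).symm
            filter_upwards [mem_nhdsWithin_of_mem_nhds (isOpen_ne.mem_nhds this)] with t ht
            exact sub_ne_zero.2 ht
        filter_upwards [eventually_all.2 this] with t ht
        exact M.differentiableAt_trace hp (Finset.prod_ne_zero_iff.2 fun k _ => ht k) hBd
      · rw [continuousAt_iff_punctured_nhds, htr0]
        exact M.tendsto_trace hp i (hB0 i)
    · exact M.differentiableAt_trace hp ht hBd
  set N := n * (p + j) with hN
  have hN0 : 0 < N := Nat.mul_pos hn (by omega)
  -- At infinity `η / dx` has order at least `2`, `y ^ (p + j)` has order `-N` and `x ^ (2 - N)` has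
  -- order `N - 2`. Hence the trace is `O(t ^ (N - 2))`.
  obtain ⟨C, R, hCR⟩ := M.exists_bound_of_bounded_infinity
    (B := M.ratio η * (M.y ^ ((p + j : ℕ) : ℤ) * (fun q => M.x q - 0) ^ (2 - N : ℤ)))
    fun q hq => by
      obtain ⟨hym, hyo⟩ := M.order_y_infinity hp hr hq
      obtain ⟨hxm, hxo⟩ := M.order_x_sub_infinity hp hr hq 0
      obtain ⟨h1, h2⟩ := M.order_ratio_mul (q := q) hη (a := -2) (s := 0)
        (g := M.y ^ ((p + j : ℕ) : ℤ) * (fun q => M.x q - 0) ^ (2 - N : ℤ))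
        ⟨(hym.zpow _).mul (hxm.zpow _), by
          rw [order_mul (hym.zpow _) (hxm.zpow _), order_zpow hym, order_zpow hxm, hyo, hxo]
          change (((p + j : ℕ) : ℤ) : WithTop ℤ) * ((-n : ℤ) : WithTop ℤ) +
            ((2 - N : ℤ) : WithTop ℤ) * ((-1 : ℤ) : WithTop ℤ) = _
          rw [← WithTop.coe_mul, ← WithTop.coe_mul, ← WithTop.coe_add, hN]
          congr 1
          push_cast
          ring⟩
        (M.coeff_dx_infinity hp hr hq) (by norm_num)
      exact h1.exists_norm_le h2
  refine hd.exists_polynomial_of_growth (N - 1) (C := p * C) ?_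
  have hlarge := (tendsto_norm_cobounded_atTop (E := ℂ)).eventually_gt_atTop (max R 1)
  filter_upwards [hlarge] with t ht
  have ht0 : 0 < ‖t‖ := one_pos.trans ((le_max_right _ _).trans_lt ht)
  have htr : ‖M.trace B t‖ ≤ p * (C * ‖t‖ ^ (N - 2 : ℤ)) := by
    refine M.norm_trace_le hp B fun q hq hx => ?_
    have h := hCR q hq (by rw [hx]; exact (le_max_left _ _).trans_lt ht)
    have h2 : B q = (M.ratio η * (M.y ^ ((p + j : ℕ) : ℤ) *
        (fun q => M.x q - 0) ^ (2 - N : ℤ))) q * t ^ (N - 2 : ℤ) := by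
      simp only [hB, Pi.mul_apply, Pi.pow_apply, sub_zero, hx, mul_assoc]
      rw [← zpow_add₀ (norm_pos_iff.1 ht0)]
      simp
    rw [h2, norm_mul, norm_zpow]
    exact mul_le_mul_of_nonneg_right h (zpow_nonneg ht0.le _)
  have hpow : ‖t‖ ^ (N - 2 : ℤ) * ‖t‖ = ‖t‖ ^ (N - 1) := by
    rw [← zpow_add_one₀ ht0.ne', ← zpow_natCast]
    congr 1
    omega
  calc ‖M.trace B t‖ * ‖t‖ ≤ p * (C * ‖t‖ ^ (N - 2 : ℤ)) * ‖t‖ := by gcongr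
    _ = p * C * (‖t‖ ^ (N - 2 : ℤ) * ‖t‖) := by ring
    _ = _ := by rw [hpow]

/-- The traces of `(η / dx) y ^ j` are polynomials. -/
theorem exists_polynomial_trace_eq (hp : p ≠ 0) (hn : 0 < n) (hr : r = n * p)
    (he : Function.Injective e) (hη : η ∈ holomorphicForms X) (j : ℕ) :
    ∃ P ∈ degreeLT ℂ (n * j - 1), ∀ t,
      M.trace (M.ratio η * M.y ^ ((p + j : ℕ) : ℤ)) t = (∏ i, (t - e i)) * P.eval t := by
  obtain ⟨Q, hQ, hQt⟩ := M.exists_polynomial_trace hp hn hr he hη j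
  -- The trace vanishes at the distinct points `e i`, so the product divides it; removing the
  -- product undoes the factor `y ^ p` and lowers the degree by `n * p`.
  have hroot : ∀ i, Q.eval (e i) = 0 := fun i => by
    rw [← hQt, ← norm_le_zero_iff]
    refine (M.norm_trace_le hp (C := 0) _ fun q hq hx => ?_).trans (by simp)
    rw [Pi.mul_apply, Pi.pow_apply, M.y_eq_zero_of_x_eq hp hq hx, zpow_natCast,
      zero_pow (by omega), mul_zero, norm_zero]
  obtain ⟨P, rfl⟩ : (∏ i, (Polynomial.X - C (e i))) ∣ Q :=
    Fintype.prod_dvd_of_coprime (pairwise_coprime_X_sub_C he) fun i =>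
      dvd_iff_isRoot.2 (hroot i)
  refine ⟨P, ?_, fun t => by rw [hQt, eval_mul, eval_prod]; simp⟩
  by_cases hP : P = 0
  · rw [hP]; exact Submodule.zero_mem _
  have hm : (∏ i, (Polynomial.X - C (e i))).Monic := monic_prod_of_monic _ _ fun i _ => monic_X_sub_C _
  have hd : (∏ i, (Polynomial.X - C (e i))).natDegree = n * p := by
    rw [natDegree_prod_of_monic _ _ fun i _ => monic_X_sub_C _]
    simp [hr]
  rw [mem_degreeLT] at hQ ⊢
  rw [degree_eq_natDegree (mul_ne_zero hm.ne_zero hP), hm.natDegree_mul' hP, hd] at hQ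
  rw [degree_eq_natDegree hP]
  have hQ' : n * p + P.natDegree < n * (p + j) - 1 := by exact_mod_cast hQ
  rw [mul_add] at hQ'
  exact_mod_cast (by omega : P.natDegree < n * j - 1)

/-- Fourier inversion over the sheets: `η / dx` is `p⁻¹` times the sum over `0 ≤ j < p` of `y⁻ʲ`
times the trace of `(η / dx) y ^ j`. -/
theorem ratioMap_mem_range (hp : p ≠ 0) (hn : 0 < n) (hr : r = n * p)
    (he : Function.Injective e) (hη : η ∈ holomorphicForms X) :
    M.ratioMap η ∈ LinearMap.range (polynomialMap p n M) := by
  choose P hP hPt using fun j : ℕ => M.exists_polynomial_trace_eq hp hn hr he hη j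
  have hζ := Complex.isPrimitiveRoot_exp p hp
  set ζ := Complex.exp (2 * Real.pi * Complex.I / p)
  refine ⟨fun j => ⟨(p : ℂ)⁻¹ • P j, Submodule.smul_mem _ _ (hP j)⟩, ?_⟩
  ext ⟨q, hq, hy⟩
  set T : ℕ → ℂ := fun k => M.onCurve (M.ratio η) (M.x q, ζ ^ k * M.y q)
  have hpow := M.y_pow hq
  have hp' : (p : ℂ) ≠ 0 := by exact_mod_cast hp
  have key : ∀ j : Fin p, (P j).eval (M.x q) * (M.y q ^ (j : ℕ))⁻¹ =
      ∑ k ∈ Finset.range p, T k * (ζ ^ k) ^ (j : ℕ) := fun j => by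
    have h1 := hPt j (M.x q)
    rw [M.trace_eq _ hζ hpow, ← hpow] at h1
    have h2 : (P j).eval (M.x q) =
        (∑ k ∈ Finset.range p, T k * (ζ ^ k) ^ (j : ℕ)) * M.y q ^ (j : ℕ) := by
      refine mul_left_cancel₀ (pow_ne_zero p hy) ?_
      rw [← h1, Finset.sum_mul, Finset.mul_sum]
      refine Finset.sum_congr rfl fun k _ => ?_
      have hk := pow_mul_pow_eq hζ k hpow
      have hk1 : (ζ ^ k) ^ p = 1 := by rw [← pow_mul, mul_comm, pow_mul, hζ.pow_eq_one, one_pow]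
      simp only [T]
      rw [M.onCurve_mk _ hk, M.onCurve_mk _ hk, Pi.mul_apply, Pi.pow_apply, y_emb, zpow_natCast,
        pow_add, mul_pow, mul_pow, hk1]
      ring
    rw [h2, mul_assoc, mul_inv_cancel₀ (pow_ne_zero _ hy), mul_one]
  -- Orthogonality of characters: the contributions of all sheets but the one through `q` cancel.
  have hsum : ∀ k ∈ Finset.range p, k ≠ 0 → T k * ∑ j : Fin p, (ζ ^ k) ^ (j : ℕ) = 0 := by
    intro k hk hk0
    have hk1 : (ζ ^ k) ^ p = 1 := by rw [← pow_mul, mul_comm, pow_mul, hζ.pow_eq_one, one_pow]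
    have hne : ζ ^ k ≠ 1 := hζ.pow_ne_one_of_pos_of_lt hk0 (Finset.mem_range.1 hk)
    rw [Fin.sum_univ_eq_sum_range (fun j => (ζ ^ k) ^ j), geom_sum_eq hne, hk1, sub_self, zero_div,
      mul_zero]
  have h0 : T 0 = M.ratio η q := by
    obtain ⟨z, rfl⟩ := hq
    simp only [T, pow_zero, one_mul, x_emb, y_emb]
    exact M.onCurve_apply _ z
  change ∑ j : Fin p, ((p : ℂ)⁻¹ • P j).eval (M.x q) * (M.y q ^ (j : ℕ))⁻¹ = M.ratio η q
  simp only [eval_smul, smul_eq_mul, mul_assoc, key]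
  rw [← Finset.mul_sum, Finset.sum_comm]
  simp only [← Finset.mul_sum]
  rw [Finset.sum_eq_single 0 hsum (by simp [Nat.pos_of_ne_zero hp])]
  simp only [pow_zero, one_pow, Finset.sum_const, Finset.card_univ, Fintype.card_fin, h0,
    nsmul_eq_mul, mul_one]
  rw [mul_comm (M.ratio η q), inv_mul_cancel_left₀ hp']

end trace

section monomials

/-- The form `x ^ a y⁻ʲ dx` has order at least `p - 1 - j` at a branch point, and `n j - a - 2` at
infinity. The bounds on `j` and `a` make both nonnegative. -/
theorem monomial_mem_map (hp : p ≠ 0) (hr : r = n * p) (he : Function.Injective e) {a j : ℕ}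
    (ha : a < n * j - 1) (hj : j < p) :
    (fun q : M.regularSet => M.x q ^ a * (M.y q ^ j)⁻¹) ∈
      (holomorphicForms X).map M.ratioMap := by
  set g : X → ℂ := fun q => M.x q ^ a * (M.y q ^ j)⁻¹
  have hg : g = M.x ^ a * M.y ^ (-j : ℤ) := by ext q; simp [g]
  have hxa : ∀ q ∈ range M.emb, IsMeromorphicAt (M.x ^ a) q ∧ 0 ≤ order (M.x ^ a) q :=
    fun q hq => by
      have h := (M.eventually_nhds_mdifferentiableAt_x hq).mono fun q' h => h.pow a
      exact ⟨isMeromorphicAt_of_mdifferentiableAt h, order_nonneg_of_mdifferentiableAt h⟩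
  have hreg : ∀ q ∈ M.regularSet, M.regularSet ∈ 𝓝 q ∧
      AnalyticAt ℂ (OneForm.coeff (fun q => g q • differential M.x q) q) (chartAt ℂ q q) :=
    fun q hq => by
      refine ⟨M.regularSet_mem_nhds hq, ?_⟩
      rw [OneForm.coeff_smul]
      refine AnalyticAt.mul (analyticAt_comp_symm ?_) (M.analyticAt_coeff_dx hp hq).1
      filter_upwards [M.regularSet_mem_nhds hq] with q' hq'
      exact ((M.mdifferentiableAt_x hq'.1).pow a).mul
        (((M.mdifferentiableAt_y hq'.1).pow j).inv (pow_ne_zero j hq'.2))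
  obtain ⟨η, hη, hηv⟩ := exists_mem_holomorphicForms (U := M.regularSet)
    (η₀ := fun q => g q • differential M.x q) (fun q => M.eventually_nhdsNE_y_ne_zero hp q) hreg
    fun q => by
      by_cases hq : q ∈ M.regularSet
      · exact ⟨(hreg q hq).2.meromorphicAt, (hreg q hq).2.meromorphicOrderAt_nonneg⟩
      have key : ∀ {b : ℤ}, IsMeromorphicAt g q →
          MeromorphicAt ((differential M.x).coeff q) (chartAt ℂ q q) ∧
            meromorphicOrderAt ((differential M.x).coeff q) (chartAt ℂ q q) = (b : WithTop ℤ) →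
          0 ≤ order g q + (b : WithTop ℤ) →
          MeromorphicAt (OneForm.coeff (fun q => g q • differential M.x q) q) (chartAt ℂ q q) ∧
          0 ≤ meromorphicOrderAt (OneForm.coeff (fun q => g q • differential M.x q) q)
            (chartAt ℂ q q) := by
        rintro b h1 ⟨h3, h4⟩ h5
        rw [OneForm.coeff_smul]
        refine ⟨MeromorphicAt.mul h1 h3, ?_⟩
        rwa [meromorphicOrderAt_mul h1 h3, h4]
      rcases M.y_ne_zero_or hp q with h | ⟨k, rfl⟩ | hqr
      · exact absurd h hq
      · have hqr := M.branchPoint_mem_range hp k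
        have hx := M.x_branchPoint hp k
        have hym := M.isMeromorphicAt_y hqr
        refine key (hg ▸ (hxa _ hqr).1.mul (hym.zpow _)) (M.coeff_dx_branch hp he hqr hx) ?_
        rw [hg, order_mul (hxa _ hqr).1 (hym.zpow _), order_zpow hym, M.order_y_branch hp he hqr hx,
          add_assoc]
        refine add_nonneg (hxa _ hqr).2 ?_
        change (0 : ℤ) ≤ ((-j : ℤ) : WithTop ℤ) * ((1 : ℤ) : WithTop ℤ) + ((p - 1 : ℤ) : WithTop ℤ)
        rw [← WithTop.coe_mul, ← WithTop.coe_add, WithTop.coe_le_coe]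
        omega
      · obtain ⟨hym, hyo⟩ := M.order_y_infinity hp hr hqr
        obtain ⟨hxm, hxo⟩ := M.order_x_sub_infinity hp hr hqr 0
        have hg' : g = (fun q => M.x q - 0) ^ (a : ℤ) * M.y ^ (-j : ℤ) := by
          rw [hg]; ext q; simp
        refine key (hg' ▸ (hxm.zpow _).mul (hym.zpow _)) (M.coeff_dx_infinity hp hr hqr) ?_
        rw [hg', order_mul (hxm.zpow _) (hym.zpow _), order_zpow hym, order_zpow hxm, hyo, hxo]
        change (0 : ℤ) ≤ ((a : ℤ) : WithTop ℤ) * ((-1 : ℤ) : WithTop ℤ) +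
          ((-j : ℤ) : WithTop ℤ) * ((-n : ℤ) : WithTop ℤ) + ((-2 : ℤ) : WithTop ℤ)
        rw [← WithTop.coe_mul, ← WithTop.coe_mul, ← WithTop.coe_add, ← WithTop.coe_add,
          WithTop.coe_le_coe]
        have h2 : (a : ℤ) + 2 ≤ n * j := by exact_mod_cast (by omega : a + 2 ≤ n * j)
        linarith
  refine ⟨η, hη, ?_⟩
  ext ⟨q, hq⟩
  change η.val q / (differential M.x).val q = g q
  rw [hηv q hq]
  have h0 : (differential M.x).val q ≠ 0 := fun h => by
    refine (M.analyticAt_coeff_dx hp hq).2 ?_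
    rw [OneForm.coeff_eq, (chartAt ℂ q).left_inv (mem_chart_source ℂ q), h, mul_zero]
  exact mul_div_cancel_right₀ _ h0

theorem range_polynomialMap_le (hp : p ≠ 0) (hr : r = n * p) (he : Function.Injective e) :
    LinearMap.range (polynomialMap p n M) ≤ (holomorphicForms X).map M.ratioMap := by
  rintro _ ⟨P, rfl⟩
  have : polynomialMap p n M P = ∑ j : Fin p, ∑ a ∈ (P j).1.support, (P j).1.coeff a •
      fun q : M.regularSet => M.x q ^ a * (M.y q ^ (j : ℕ))⁻¹ := by
    ext q
    simp only [polynomialMap, LinearMap.coe_mk, AddHom.coe_mk, Finset.sum_apply, Pi.smul_apply,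
      eval_eq_sum, Polynomial.sum, Finset.sum_mul, smul_eq_mul, mul_assoc]
  rw [this]
  refine Submodule.sum_mem _ fun j _ => Submodule.sum_mem _ fun a ha => Submodule.smul_mem _ _ ?_
  refine M.monomial_mem_map hp hr he ?_ j.2
  have h1 := le_degree_of_mem_supp a ha
  exact_mod_cast h1.trans_lt (mem_degreeLT.1 (P j).2)

end monomials

/-- The genus of a `p`-gonal surface. -/
theorem two_mul_genus_sub_two {e : Fin r → ℂ} (M : PGonalModel p e X) [CompactSpace X] (hp : p ≠ 0) (hn : 0 < n) (hr : r = n * p)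
    (he : Function.Injective e) : 2 * (genus X : ℤ) - 2 = p * (n * (p - 1) - 2) := by
  have hmap : (holomorphicForms X).map M.ratioMap = LinearMap.range (polynomialMap p n M) := by
    refine le_antisymm ?_ (M.range_polynomialMap_le hp hr he)
    rintro _ ⟨η, hη, rfl⟩
    exact M.ratioMap_mem_range hp hn hr he hη
  have hinj : Function.Injective (M.ratioMap.domRestrict (holomorphicForms X)) := by
    refine (injective_iff_map_eq_zero _).2 ?_
    exact fun η hη => Subtype.ext (M.ratioMap_injOn hp hr he η.2 hη)
  have h1 : genus X = ∑ j : Fin p, (n * j - 1) := by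
    rw [genus, (LinearEquiv.ofInjective _ hinj).finrank_eq, LinearMap.range_domRestrict, hmap,
      ← (LinearEquiv.ofInjective _ (M.polynomialMap_injective hp)).finrank_eq,
      Module.finrank_pi_fintype]
    refine Finset.sum_congr rfl fun j _ => ?_
    rw [(degreeLTEquiv ℂ (n * j - 1)).finrank_eq, Module.finrank_fin_fun]
  -- The index `j = 0` is split off: there the truncated `n * j - 1` is `0`, whereas for the other
  -- indices the subtraction is exact since `n > 0`.
  obtain ⟨p', rfl⟩ := Nat.exists_eq_succ_of_ne_zero hp
  have h2 : ∀ m : ℕ, 2 * ((∑ j ∈ Finset.range m, (n * (j + 1) - 1) : ℕ) : ℤ) =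
      n * m * (m + 1) - 2 * m := fun m => by
    induction m with
    | zero => simp
    | succ m ih =>
      rw [Finset.sum_range_succ, Nat.cast_add, mul_add, ih,
        Nat.cast_sub (Nat.mul_pos hn (Nat.succ_pos m))]
      push_cast
      ring
  rw [h1, Fin.sum_univ_succ]
  have h3 := h2 p'
  rw [← Fin.sum_univ_eq_sum_range (fun j => n * (j + 1) - 1)] at h3
  simp only [Fin.val_zero, mul_zero, zero_tsub, zero_add, Fin.val_succ]
  rw [h3]
  push_cast
  ring

end PGonalModel

end

theorem mainTheorem2 {X : Type*} [TopologicalSpace X] [T2Space X] [CompactSpace X]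
    [ConnectedSpace X] [ChartedSpace ℂ X] [IsManifold 𝓘(ℂ) ω X]
    (p n r m : ℕ) (hp : p.Prime) (hn : 0 < n) (hr : r = n * p)
    (e : Fin r → ℂ) (he : Function.Injective e) (M : PGonalModel p e X)
    (hm : 0 < m) (hpm : p ∣ m) (hmg : (m : ℤ) ∣ 2 * (RiemannSurface.genus X : ℤ) - 2) :
    {c : RiemannSurface.DivisorClass X |
      RiemannSurface.IsSpin m c ∧ RiemannSurface.IsSupportedOn M.branchSet c}.ncard =
        p ^ (r - 2) := by
  rw [M.two_mul_genus_sub_two hp.ne_zero hn hr he] at hmg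
  have h2 : 2 ≤ r := hr ▸ hp.two_le.trans (Nat.le_mul_of_pos_left p hn)
  obtain ⟨k, rfl⟩ := Nat.exists_eq_add_of_le' h2
  exact M.ncard_spin hp.ne_zero hr he hm hpm hmg
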